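/- Let $\mathbb K=\mathbb R$ or $\mathbb C$, let $n\ge 1$ and $1\le p<\infty$ with $\frac1p+\frac1{p'}=1$, and let $E_1,\dots,E_n,F$ be Banach spaces over $\mathbb K$. Write $B_X$ for the closed unit ball and $X'$ for the topological dual of a Banach space $X$, and let $\mathcal L(E_1,\dots,E_n;F)$ be the space of continuous $n$-linear operators $E_1\times\cdots\times E_n\to F$. For $x_i'\in E_i'$ and $y\in F$ let $x_1'\otimes\cdots\otimes x_n'\otimes y$ be the operator $(x_1,\dots,x_n)\mapsto x_1'(x_1)\cdots x_n'(x_n)\,y$. An operator $A\in\mathcal L(E_1,\dots,E_n;F)$ is $\sigma(p)$-nuclear if there are $(\lambda_j)_{j=1}^\infty\in\ell_{p'}$, sequences $(x_{ij}')_{j=1}^\infty$ in $E_i'$ and a sequence $(y_j)_{j=1}^\infty$ in $F$ such that $A(x_1,\dots,x_n)=\sum_{j=1}^\infty\lambda_j x_{1j}'(x_1)\cdots x_{nj}'(x_n)y_j$ for all $x_i\in E_i$ and, with $$w_m:=\sup_{x_i\in B_{E_i},\,y'\in B_{F'}}\Bigl(\sum_{j=m}^\infty|x_{1j}'(x_1)\cdots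 x_{nj}'(x_n)\,y'(y_j)|^p\Bigr)^{1/p},$$ one has $w_1<\infty$ and $\lim_{m\to\infty}w_m=0$. The space $\mathcal L_{\sigma(p)}(E_1,\dots,E_n;F)$ of these operators carries the norm $\|A\|_{\sigma(p)}:=\inf\|(\lambda_j)_j\|_{p'}\,w_1$, the infimum being over all such representations of $A$. For Banach spaces $D_1,\dots,D_n,G$ over $\mathbb K$, an operator $S\in\mathcal L(D_1,\dots,D_n;G)$ is $\tau(p)$-summing if there is $C\ge0$ such that $$\Bigl(\sum_{j=1}^m|b_j'(S(x_{1j},\dots,x_{nj}))|^p\Bigr)^{1/p}\le C\sup_{x_i'\in B_{D_i'},\,y\in B_G}\Bigl(\sum_{j=1}^m|x_1'(x_{1j})\cdots x_n'(x_{nj})\,b_j'(y)|^p\Bigr)^{1/p}$$ for all $m\in\mathbb N$, $x_{ij}\in D_i$ and $b_j'\in G'$. The space $\mathcal L_{\tau(p)}(D_1,\dots,D_n;G)$ of these operators carries the norm $\|S\|_{\tau(p)}$, the infimum of all such $C$. Suppose that $E_1',\dots,E_n'$ have the bounded approximation property (a Banach space $X$ has it if there is $\gamma\ge1$ such that for every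 compact $K\subset X$ and $\varepsilon>0$ some finite rank operator $T\colon X\to X$ satisfies $\|T\|\le\gamma$ and $\|Tx-x\|\le\varepsilon$ for all $x\in K$) and that $F$ is reflexive. Then the Borel transform $$\mathcal B(\varphi)(x_1',\dots,x_n')(y)=\varphi(x_1'\otimes\cdots\otimes x_n'\otimes y)\qquad(x_i'\in E_i',\ y\in F)$$ is an isometric linear isomorphism from $[\mathcal L_{\sigma(p)}(E_1,\dots,E_n;F),\|\cdot\|_{\sigma(p)}]'$ onto $[\mathcal L_{\tau(p)}(E_1',\dots,E_n';F'),\|\cdot\|_{\tau(p)}]$. In particular (case $n=1$), if $E'$ has the bounded approximation property and $F$ is reflexive, then $[\mathcal L_{\sigma(p)}(E;F)]'=\mathcal L_{\tau(p)}(E';F')$ isometrically. -/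

import Mathlib

open scoped ENNReal Topology

noncomputable section

/-! ### Banach space notions -/

/-- The bounded approximation property of a normed space: for some `γ`, the identity can be
approximated uniformly on compact sets by finite rank operators of norm at most `γ`. -/
def HasBoundedApproximationProperty (𝕜 X : Type*) [RCLike 𝕜] [NormedAddCommGroup X]
    [NormedSpace 𝕜 X] : Prop :=
  ∃ γ : ℝ, 1 ≤ γ ∧ ∀ K : Set X, IsCompact K → ∀ ε : ℝ, 0 < ε →
    ∃ T : X →L[𝕜] X, FiniteDimensional 𝕜 T.range ∧ ‖T‖ ≤ γ ∧ ∀ x ∈ K, ‖T x - x‖ ≤ ε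

/-- Reflexivity: the canonical embedding into the bidual is onto. -/
def IsReflexiveSpace (𝕜 X : Type*) [RCLike 𝕜] [NormedAddCommGroup X] [NormedSpace 𝕜 X] : Prop :=
  Function.Surjective (NormedSpace.inclusionInDoubleDual 𝕜 X)

/-- The conjugate exponent `p'` of `p`, with `1/p + 1/p' = 1`; it is `∞` for `p = 1`. -/
def conjExp (p : ℝ) : ℝ≥0∞ := ENNReal.conjExponent (ENNReal.ofReal p)

theorem conjExp_one : conjExp 1 = ∞ := by
  simp [conjExp, ENNReal.conjExponent]

theorem conjExp_holder {p : ℝ} (hp : 1 < p) :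
    conjExp p ≠ ∞ ∧ p.HolderConjugate (conjExp p).toReal := by
  have h1 : 0 < p - 1 := sub_pos.2 hp
  have h : conjExp p = 1 + ENNReal.ofReal ((p - 1)⁻¹) := by
    rw [conjExp, ENNReal.conjExponent, ENNReal.ofReal_inv_of_pos h1,
      ENNReal.ofReal_sub _ zero_le_one, ENNReal.ofReal_one]
  have h2 : (conjExp p).toReal = 1 + (p - 1)⁻¹ := by
    rw [h, ENNReal.toReal_add (by simp) (by simp), ENNReal.toReal_ofReal (by positivity)]
    simp
  refine ⟨by rw [h]; simp, ?_⟩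
  rw [Real.holderConjugate_iff_eq_conjExponent hp, h2]
  field_simp
  ring

theorem conjExp_ne_zero {p : ℝ} (_hp : 1 ≤ p) : conjExp p ≠ 0 := by
  simp [conjExp, ENNReal.conjExponent]

theorem conjExp_add {p : ℝ} (hp : 1 ≤ p) : 1 / p + 1 / (conjExp p).toReal = 1 := by
  rcases hp.eq_or_lt with rfl | hp
  · simp [conjExp_one]
  · simpa using (conjExp_holder hp).2.inv_add_inv_eq_one

/-! ### `σ(p)`-nuclear operators -/

section SigmaNuclear

variable {𝕜 : Type*} [RCLike 𝕜] {n : ℕ} {E : Fin n → Type*} {F : Type*}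
  [∀ i, NormedAddCommGroup (E i)] [∀ i, NormedSpace 𝕜 (E i)]
  [NormedAddCommGroup F] [NormedSpace 𝕜 F]

/-- The operator `x'₁ ⊗ ⋯ ⊗ x'ₙ ⊗ y`, that is `(x₁, …, xₙ) ↦ x'₁(x₁) ⋯ x'ₙ(xₙ) y`. -/
def elemTensor (x' : ∀ i, StrongDual 𝕜 (E i)) (y : F) : ContinuousMultilinearMap 𝕜 E F :=
  ((ContinuousMultilinearMap.mkPiAlgebra 𝕜 (Fin n) 𝕜).compContinuousLinearMap x').smulRight y

@[simp] theorem elemTensor_apply (x' : ∀ i, StrongDual 𝕜 (E i)) (y : F) (x : ∀ i, E i) :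
    elemTensor x' y x = (∏ i, x' i (x i)) • y := by
  simp [elemTensor]

/-- `sup (∑_{j ≥ m} |x'₁ⱼ(x₁) ⋯ x'ₙⱼ(xₙ) y'(yⱼ)|^p)^{1/p}`, the supremum being over `xᵢ` in the
closed unit ball of `Eᵢ` and `y'` in the closed unit ball of `F'`. Sequences are indexed from `0`
here, so that `m = 0` gives the supremum for the whole sequence. The value is in `[0, ∞]`. -/
def sigmaTail (p : ℝ) (x' : ℕ → ∀ i, StrongDual 𝕜 (E i)) (y : ℕ → F) (m : ℕ) : ℝ≥0∞ :=
  ⨆ (x : ∀ i, E i) (_ : ∀ i, ‖x i‖ ≤ 1) (y' : StrongDual 𝕜 F) (_ : ‖y'‖ ≤ 1),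
    (∑' j : Set.Ici m, ‖(∏ i, x' j i (x i)) * y' (y j)‖ₑ ^ p) ^ (1 / p)

/-- `A = ∑ⱼ λⱼ x'₁ⱼ ⊗ ⋯ ⊗ x'ₙⱼ ⊗ yⱼ` is a `σ(p)`-nuclear representation of `A`. -/
structure IsSigmaRep (p : ℝ) (A : ContinuousMultilinearMap 𝕜 E F)
    (lam : lp (fun _ : ℕ => 𝕜) (conjExp p)) (x' : ℕ → ∀ i, StrongDual 𝕜 (E i)) (y : ℕ → F) :
    Prop where
  tendsto_sum : ∀ x : ∀ i, E i,
    Filter.Tendsto (fun N => ∑ j ∈ Finset.range N, lam j • elemTensor (x' j) (y j) x)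
      Filter.atTop (𝓝 (A x))
  sup_lt_top : sigmaTail p x' y 0 < ∞
  tendsto_tail : Filter.Tendsto (fun m => sigmaTail p x' y m) Filter.atTop (𝓝 0)

/-- `A` is `σ(p)`-nuclear if it has a `σ(p)`-nuclear representation. -/
def IsSigmaNuclear (p : ℝ) (A : ContinuousMultilinearMap 𝕜 E F) : Prop :=
  ∃ lam x' y, IsSigmaRep p A lam x' y

/-- `‖A‖_{σ(p)}`, the infimum of `‖(λⱼ)‖_{p'} · sup (∑ⱼ |x'₁ⱼ(x₁) ⋯ x'ₙⱼ(xₙ) y'(yⱼ)|^p)^{1/p}`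
over the `σ(p)`-nuclear representations of `A`. -/
def sigmaNorm (p : ℝ) (A : ContinuousMultilinearMap 𝕜 E F) : ℝ :=
  sInf {c : ℝ | ∃ lam x' y, IsSigmaRep p A lam x' y ∧ c = ‖lam‖ * (sigmaTail p x' y 0).toReal}

/-! The next lemmas show that the `σ(p)`-nuclear operators form a normed space. -/

theorem sigmaTail_le_iff {p : ℝ} (hp : 1 ≤ p) {x' : ℕ → ∀ i, StrongDual 𝕜 (E i)} {y : ℕ → F}
    {m : ℕ} {c : ℝ≥0∞} : sigmaTail p x' y m ≤ c ↔
      ∀ x : ∀ i, E i, (∀ i, ‖x i‖ ≤ 1) → ∀ y' : StrongDual 𝕜 F, ‖y'‖ ≤ 1 →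
        ∑' j : Set.Ici m, ‖(∏ i, x' j i (x i)) * y' (y j)‖ₑ ^ p ≤ c ^ p := by
  simp only [sigmaTail, iSup_le_iff, one_div]
  have : ∀ a : ℝ≥0∞, a ^ p⁻¹ ≤ c ↔ a ≤ c ^ p := fun a =>
    ENNReal.rpow_inv_le_iff (by linarith)
  simp only [this]

theorem le_sigmaTail {p : ℝ} (hp : 1 ≤ p) (x' : ℕ → ∀ i, StrongDual 𝕜 (E i)) (y : ℕ → F) (m : ℕ)
    {x : ∀ i, E i} (hx : ∀ i, ‖x i‖ ≤ 1) {y' : StrongDual 𝕜 F} (hy : ‖y'‖ ≤ 1) :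
    ∑' j : Set.Ici m, ‖(∏ i, x' j i (x i)) * y' (y j)‖ₑ ^ p ≤ sigmaTail p x' y m ^ p :=
  (sigmaTail_le_iff hp).1 le_rfl x hx y' hy

theorem IsSigmaRep.smul {p : ℝ} {A : ContinuousMultilinearMap 𝕜 E F}
    {lam : lp (fun _ : ℕ => 𝕜) (conjExp p)} {x' : ℕ → ∀ i, StrongDual 𝕜 (E i)} {y : ℕ → F}
    (h : IsSigmaRep p A lam x' y) (c : 𝕜) : IsSigmaRep p (c • A) (c • lam) x' y where
  tendsto_sum x := by
    have := (h.tendsto_sum x).const_smul c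
    simpa [Finset.smul_sum, smul_smul, mul_assoc] using this
  sup_lt_top := h.sup_lt_top
  tendsto_tail := h.tendsto_tail

theorem sigmaTail_rescale {p : ℝ} (hp : 1 ≤ p) (x' : ℕ → ∀ i, StrongDual 𝕜 (E i)) (y : ℕ → F)
    (m : ℕ) {t : ℝ} (ht : 0 < t) :
    sigmaTail p x' (fun j => ((t⁻¹ : ℝ) : 𝕜) • y j) m
      ≤ ENNReal.ofReal t⁻¹ * sigmaTail p x' y m := by
  rw [sigmaTail_le_iff hp]
  intro x hx y' hy
  have h0 : (0 : ℝ) ≤ p := by linarith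
  rw [ENNReal.mul_rpow_of_nonneg _ _ h0]
  refine le_trans (le_of_eq ?_) (mul_le_mul_right (le_sigmaTail hp x' y m hx hy) _)
  rw [← ENNReal.tsum_mul_left]
  refine tsum_congr fun j => ?_
  rw [← ENNReal.mul_rpow_of_nonneg _ _ h0]
  congr 1
  have h1 : ‖((t⁻¹ : ℝ) : 𝕜)‖ₑ = ENNReal.ofReal t⁻¹ := by
    rw [← ofReal_norm, RCLike.norm_ofReal, abs_of_pos (inv_pos.2 ht)]
  simp only [map_smul, smul_eq_mul, enorm_mul, h1]
  ring

/-- Rescaling a representation so that both factors are balanced. -/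
theorem IsSigmaRep.normalize {p : ℝ} (hp : 1 ≤ p) {A : ContinuousMultilinearMap 𝕜 E F}
    {lam : lp (fun _ : ℕ => 𝕜) (conjExp p)} {x' : ℕ → ∀ i, StrongDual 𝕜 (E i)} {y : ℕ → F}
    (h : IsSigmaRep p A lam x' y) {b : ℝ} (hb : 0 < b)
    (hlt : ‖lam‖ * (sigmaTail p x' y 0).toReal ≤ b) :
    ∃ (lam' : lp (fun _ : ℕ => 𝕜) (conjExp p)) (y2 : ℕ → F), IsSigmaRep p A lam' x' y2 ∧
      ‖lam'‖ ≤ b ^ (1 / (conjExp p).toReal) ∧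
      sigmaTail p x' y2 0 ≤ ENNReal.ofReal (b ^ (1 / p)) := by
  set L := ‖lam‖ with hL
  have hL0 : 0 ≤ L := lp.norm_nonneg' lam
  set w := (sigmaTail p x' y 0).toReal with hw
  have hw0 : 0 ≤ w := ENNReal.toReal_nonneg
  have hbp : 0 < b ^ (1 / p) := Real.rpow_pos_of_pos hb _
  have hbq : 0 < b ^ (1 / (conjExp p).toReal) := Real.rpow_pos_of_pos hb _
  have hbb : b ^ (1 / p) * b ^ (1 / (conjExp p).toReal) = b := by
    rw [← Real.rpow_add hb, conjExp_add hp, Real.rpow_one]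
  obtain ⟨t, ht, ht1, ht2⟩ : ∃ t : ℝ, 0 < t ∧ t * L ≤ b ^ (1 / (conjExp p).toReal) ∧
      t⁻¹ * w ≤ b ^ (1 / p) := by
    rcases hL0.eq_or_lt with h0 | h0
    · refine ⟨w * (b ^ (1 / p))⁻¹ + 1, by positivity, by rw [← h0]; simpa using hbq.le, ?_⟩
      rw [inv_mul_le_iff₀ (by positivity), add_mul, mul_assoc, inv_mul_cancel₀ hbp.ne']
      linarith
    · refine ⟨b ^ (1 / (conjExp p).toReal) / L, by positivity, by field_simp; exact le_rfl, ?_⟩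
      rw [inv_div, div_mul_eq_mul_div, div_le_iff₀ hbq, hbb]
      exact hlt
  have hq := conjExp_ne_zero hp
  have htail := fun m => sigmaTail_rescale hp x' y m ht
  refine ⟨(t : 𝕜) • lam, fun j => ((t⁻¹ : ℝ) : 𝕜) • y j, ⟨fun x => ?_, ?_, ?_⟩, ?_, ?_⟩
  · refine (h.tendsto_sum x).congr fun N => Finset.sum_congr rfl fun j _ => ?_
    have ht' : (t : 𝕜) ≠ 0 := by exact_mod_cast ht.ne'
    simp only [lp.coeFn_smul, Pi.smul_apply, elemTensor_apply, smul_smul, smul_eq_mul]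
    congr 1
    push_cast
    field_simp
  · exact (htail 0).trans_lt (ENNReal.mul_lt_top ENNReal.ofReal_lt_top h.sup_lt_top)
  · refine tendsto_of_tendsto_of_tendsto_of_le_of_le tendsto_const_nhds ?_ (fun _ => zero_le)
      htail
    have := ENNReal.Tendsto.const_mul (a := ENNReal.ofReal t⁻¹) h.tendsto_tail
      (Or.inr ENNReal.ofReal_ne_top)
    simpa using this
  · rw [lp.norm_const_smul hq, RCLike.norm_ofReal, abs_of_pos ht]
    exact ht1
  · refine (htail 0).trans ?_
    rw [← ENNReal.ofReal_toReal h.sup_lt_top.ne, ← ENNReal.ofReal_mul (by positivity)]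
    exact ENNReal.ofReal_le_ofReal ht2

/-- The sequence `u 0, v 0, u 1, v 1, …`. -/
def interleave {X : Type*} (u v : ℕ → X) (j : ℕ) : X :=
  if j % 2 = 0 then u (j / 2) else v (j / 2)

theorem interleave_even {X : Type*} (u v : ℕ → X) (k : ℕ) : interleave u v (2 * k) = u k := by
  simp [interleave]

theorem interleave_odd {X : Type*} (u v : ℕ → X) (k : ℕ) :
    interleave u v (2 * k + 1) = v k := by
  have h1 : (2 * k + 1) % 2 = 1 := by omega
  have h2 : (2 * k + 1) / 2 = k := by omega
  simp [interleave, h1, h2]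

theorem sum_interleave (u v : ℕ → F) (N : ℕ) :
    ∑ j ∈ Finset.range N, interleave u v j =
      ∑ j ∈ Finset.range ((N + 1) / 2), u j + ∑ j ∈ Finset.range (N / 2), v j := by
  induction N with
  | zero => simp
  | succ N ih =>
    rw [Finset.sum_range_succ, ih]
    rcases Nat.even_or_odd' N with ⟨k, rfl | rfl⟩
    · have h1 : (2 * k + 1) / 2 = k := by omega
      have h2 : (2 * k + 1 + 1) / 2 = k + 1 := by omega
      have h3 : 2 * k / 2 = k := by omega
      rw [interleave_even, h1, h2, h3, Finset.sum_range_succ]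
      abel
    · have h1 : (2 * k + 1) / 2 = k := by omega
      have h2 : (2 * k + 1 + 1) / 2 = k + 1 := by omega
      have h3 : (2 * k + 1 + 1 + 1) / 2 = k + 1 := by omega
      rw [interleave_odd, h1, h2, h3, Finset.sum_range_succ v]
      abel

theorem memℓp_interleave {q : ℝ≥0∞} (hq0 : q ≠ 0) (u v : lp (fun _ : ℕ => 𝕜) q) :
    Memℓp (E := fun _ : ℕ => 𝕜) (interleave u v) q := by
  rcases eq_or_ne q ∞ with rfl | hq
  · refine memℓp_infty ⟨max ‖u‖ ‖v‖, ?_⟩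
    rintro _ ⟨j, rfl⟩
    dsimp only [interleave]
    split_ifs
    · exact (lp.norm_apply_le_norm hq0 u _).trans (le_max_left _ _)
    · exact (lp.norm_apply_le_norm hq0 v _).trans (le_max_right _ _)
  · have hq' := ENNReal.toReal_pos hq0 hq
    refine memℓp_gen (HasSum.summable (HasSum.even_add_odd (f := fun i => ‖interleave u v i‖ ^ q.toReal)
      (m := ‖u‖ ^ q.toReal) (m' := ‖v‖ ^ q.toReal) ?_ ?_))
    · simpa only [interleave_even] using lp.hasSum_norm hq' u
    · simpa only [interleave_odd] using lp.hasSum_norm hq' v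

theorem norm_interleave_le {p : ℝ} (hp : 1 ≤ p) (u v : lp (fun _ : ℕ => 𝕜) (conjExp p))
    {a b : ℝ} (ha : 0 < a) (hb : 0 < b) (hu : ‖u‖ ≤ a ^ (1 / (conjExp p).toReal))
    (hv : ‖v‖ ≤ b ^ (1 / (conjExp p).toReal)) :
    ‖(⟨interleave u v, memℓp_interleave (conjExp_ne_zero hp) u v⟩ :
      lp (fun _ : ℕ => 𝕜) (conjExp p))‖ ≤ (a + b) ^ (1 / (conjExp p).toReal) := by
  rcases hp.eq_or_lt with rfl | hp1
  · have h0 : conjExp 1 ≠ 0 := conjExp_ne_zero hp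
    have key : ∀ j, ‖interleave u v j‖ ≤ 1 := by
      intro j
      simp only [conjExp_one, ENNReal.toReal_top, div_zero, Real.rpow_zero] at hu hv
      dsimp only [interleave]
      split_ifs
      · exact (lp.norm_apply_le_norm h0 u _).trans hu
      · exact (lp.norm_apply_le_norm h0 v _).trans hv
    have e : (a + b) ^ (1 / (conjExp 1).toReal) = 1 := by simp [conjExp_one]
    rw [e]
    generalize_proofs hmem
    revert hmem
    generalize interleave (u : ℕ → 𝕜) v = w at key
    rw [conjExp_one]
    intro hmem
    exact lp.norm_le_of_forall_le zero_le_one key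
  · obtain ⟨hq, hH⟩ := conjExp_holder hp1
    have hq' := ENNReal.toReal_pos (conjExp_ne_zero hp) hq
    refine lp.norm_le_of_tsum_le hq' (by positivity) ?_
    have hs := HasSum.even_add_odd (f := fun i => ‖interleave u v i‖ ^ (conjExp p).toReal)
      (by simpa only [interleave_even] using lp.hasSum_norm hq' u)
      (by simpa only [interleave_odd] using lp.hasSum_norm hq' v)
    refine (le_of_eq hs.tsum_eq).trans ?_
    rw [one_div] at *
    rw [Real.rpow_inv_rpow (by positivity) hq'.ne']
    have h1 := Real.rpow_le_rpow (lp.norm_nonneg' u) hu hq'.le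
    have h2 := Real.rpow_le_rpow (lp.norm_nonneg' v) hv hq'.le
    rw [Real.rpow_inv_rpow (by positivity) hq'.ne'] at h1 h2
    linarith

theorem sigmaTail_interleave {p : ℝ} (hp : 1 ≤ p) (x₁ x₂ : ℕ → ∀ i, StrongDual 𝕜 (E i))
    (y₁ y₂ : ℕ → F) {m k : ℕ} (hk : 2 * k ≤ m) :
    sigmaTail p (interleave x₁ x₂) (interleave y₁ y₂) m ≤
      (sigmaTail p x₁ y₁ k ^ p + sigmaTail p x₂ y₂ k ^ p) ^ (1 / p) := by
  rw [sigmaTail_le_iff hp]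
  intro x hx y' hy
  rw [one_div, ENNReal.rpow_inv_rpow (by linarith)]
  refine le_trans ?_ (add_le_add (le_sigmaTail hp x₁ y₁ k hx hy) (le_sigmaTail hp x₂ y₂ k hx hy))
  rw [tsum_subtype (Set.Ici m)
      (fun j => ‖(∏ i, interleave x₁ x₂ j i (x i)) * y' (interleave y₁ y₂ j)‖ₑ ^ p),
    tsum_subtype (Set.Ici k) (fun j => ‖(∏ i, x₁ j i (x i)) * y' (y₁ j)‖ₑ ^ p),
    tsum_subtype (Set.Ici k) (fun j => ‖(∏ i, x₂ j i (x i)) * y' (y₂ j)‖ₑ ^ p),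
    ← tsum_even_add_odd ENNReal.summable ENNReal.summable]
  refine add_le_add (ENNReal.tsum_le_tsum fun j => ?_) (ENNReal.tsum_le_tsum fun j => ?_)
  · by_cases h : m ≤ 2 * j
    · have h' : k ≤ j := by omega
      simp [Set.indicator, h, h', interleave_even]
    · simp [Set.indicator, h]
  · by_cases h : m ≤ 2 * j + 1
    · have h' : k ≤ j := by omega
      simp [Set.indicator, h, h', interleave_odd]
    · simp [Set.indicator, h]

theorem IsSigmaRep.add {p : ℝ} (hp : 1 ≤ p) {A B : ContinuousMultilinearMap 𝕜 E F}
    {lam mu : lp (fun _ : ℕ => 𝕜) (conjExp p)} {x₁ x₂ : ℕ → ∀ i, StrongDual 𝕜 (E i)}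
    {y₁ y₂ : ℕ → F} (hA : IsSigmaRep p A lam x₁ y₁) (hB : IsSigmaRep p B mu x₂ y₂) :
    IsSigmaRep p (A + B)
      ⟨interleave lam mu, memℓp_interleave (conjExp_ne_zero hp) lam mu⟩
      (interleave x₁ x₂) (interleave y₁ y₂) where
  tendsto_sum x := by
    have e : ∀ N, ∑ j ∈ Finset.range N,
        interleave lam mu j • elemTensor (interleave x₁ x₂ j) (interleave y₁ y₂ j) x =
        ∑ j ∈ Finset.range ((N + 1) / 2), lam j • elemTensor (x₁ j) (y₁ j) x +
        ∑ j ∈ Finset.range (N / 2), mu j • elemTensor (x₂ j) (y₂ j) x := by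
      intro N
      rw [← sum_interleave (fun j => lam j • elemTensor (x₁ j) (y₁ j) x)]
      refine Finset.sum_congr rfl fun j _ => ?_
      unfold interleave
      split_ifs <;> rfl
    have h2 : Filter.Tendsto (fun N : ℕ => N / 2) Filter.atTop Filter.atTop :=
      Filter.tendsto_atTop.2 fun b => (Filter.eventually_ge_atTop (2 * b)).mono fun N hN => by
        omega
    have h1 : Filter.Tendsto (fun N : ℕ => (N + 1) / 2) Filter.atTop Filter.atTop :=
      Filter.tendsto_atTop.2 fun b => (Filter.eventually_ge_atTop (2 * b)).mono fun N hN => by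
        omega
    have := ((hA.tendsto_sum x).comp h1).add ((hB.tendsto_sum x).comp h2)
    refine this.congr fun N => (e N).symm
  sup_lt_top := by
    have h0 : (0 : ℝ) ≤ p := by linarith
    refine (sigmaTail_interleave hp x₁ x₂ y₁ y₂ (k := 0) (by simp)).trans_lt ?_
    refine ENNReal.rpow_lt_top_of_nonneg (by positivity) ?_
    exact (ENNReal.add_lt_top.2 ⟨ENNReal.rpow_lt_top_of_nonneg h0 hA.sup_lt_top.ne,
      ENNReal.rpow_lt_top_of_nonneg h0 hB.sup_lt_top.ne⟩).ne
  tendsto_tail := by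
    have h0 : (0 : ℝ) < p := by linarith
    have h2 : Filter.Tendsto (fun N : ℕ => N / 2) Filter.atTop Filter.atTop :=
      Filter.tendsto_atTop.2 fun b => (Filter.eventually_ge_atTop (2 * b)).mono fun N hN => by
        omega
    refine tendsto_of_tendsto_of_tendsto_of_le_of_le tendsto_const_nhds ?_ (fun _ => zero_le)
      (fun m => sigmaTail_interleave hp x₁ x₂ y₁ y₂ (k := m / 2) (by omega))
    have ha := ((hA.tendsto_tail.comp h2).ennrpow_const p).add
      ((hB.tendsto_tail.comp h2).ennrpow_const p)
    have := ha.ennrpow_const (1 / p)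
    simpa [ENNReal.zero_rpow_of_pos h0, ENNReal.zero_rpow_of_pos (inv_pos.2 h0)] using this

/-- Hölder's inequality for finite sums. -/
theorem holder_finset {p : ℝ} (hp : 1 ≤ p) (lam : lp (fun _ : ℕ => 𝕜) (conjExp p)) (a : ℕ → 𝕜)
    (s : Finset ℕ) :
    ‖∑ j ∈ s, lam j * a j‖ ≤ ‖lam‖ * (∑ j ∈ s, ‖a j‖ ^ p) ^ (1 / p) := by
  refine (norm_sum_le _ _).trans ?_
  simp only [norm_mul]
  rcases hp.eq_or_lt with rfl | hp1
  · simp only [Real.rpow_one, div_one, Finset.mul_sum]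
    exact Finset.sum_le_sum fun j _ => mul_le_mul_of_nonneg_right
      (lp.norm_apply_le_norm (conjExp_ne_zero hp) lam j) (norm_nonneg _)
  · obtain ⟨hq, hH⟩ := conjExp_holder hp1
    have hq' := ENNReal.toReal_pos (conjExp_ne_zero hp) hq
    refine (Real.inner_le_Lp_mul_Lq_of_nonneg s hH.symm (fun _ _ => norm_nonneg _)
      (fun _ _ => norm_nonneg _)).trans ?_
    refine mul_le_mul_of_nonneg_right ?_ (by positivity)
    refine (Real.rpow_le_rpow (by positivity) (lp.sum_rpow_le_norm_rpow hq' lam s)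
      (by positivity)).trans ?_
    rw [one_div, Real.rpow_rpow_inv (lp.norm_nonneg' lam) hq'.ne']

theorem IsSigmaRep.norm_apply_le {p : ℝ} (hp : 1 ≤ p) {A : ContinuousMultilinearMap 𝕜 E F}
    {lam : lp (fun _ : ℕ => 𝕜) (conjExp p)} {x' : ℕ → ∀ i, StrongDual 𝕜 (E i)} {y : ℕ → F}
    (h : IsSigmaRep p A lam x' y) {x : ∀ i, E i} (hx : ∀ i, ‖x i‖ ≤ 1) :
    ‖A x‖ ≤ ‖lam‖ * (sigmaTail p x' y 0).toReal := by
  have h0 : (0 : ℝ) < p := by linarith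
  obtain ⟨g, hg, hgx⟩ := exists_dual_vector'' 𝕜 (A x)
  have hlim := ((g.continuous.tendsto (A x)).comp (h.tendsto_sum x)).norm
  rw [hgx] at hlim
  simp only [RCLike.norm_ofReal, abs_norm] at hlim
  refine le_of_tendsto' hlim fun N => ?_
  have e : g (∑ j ∈ Finset.range N, lam j • elemTensor (x' j) (y j) x) =
      ∑ j ∈ Finset.range N, lam j * ((∏ i, x' j i (x i)) * g (y j)) := by
    simp [map_sum]
  simp only [Function.comp_apply, e]
  refine (holder_finset hp lam _ _).trans (mul_le_mul_of_nonneg_left ?_ (lp.norm_nonneg' lam))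
  rw [one_div, Real.rpow_inv_le_iff_of_pos (by positivity) ENNReal.toReal_nonneg h0,
    ENNReal.toReal_rpow]
  have h1 := le_sigmaTail hp x' y 0 hx hg
  have hfin := ENNReal.rpow_lt_top_of_nonneg h0.le h.sup_lt_top.ne
  rw [← ENNReal.ofReal_le_iff_le_toReal hfin.ne]
  refine le_trans ?_ h1
  rw [tsum_subtype (Set.Ici 0) (fun j => ‖(∏ i, x' j i (x i)) * g (y j)‖ₑ ^ p)]
  refine le_trans (le_of_eq ?_) (ENNReal.sum_le_tsum (Finset.range N))
  rw [ENNReal.ofReal_sum_of_nonneg fun _ _ => by positivity]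
  refine Finset.sum_congr rfl fun j _ => ?_
  rw [← ENNReal.ofReal_rpow_of_nonneg (norm_nonneg _) h0.le, ofReal_norm]
  simp [Set.indicator]

theorem sigmaNorm_bddBelow (p : ℝ) (A : ContinuousMultilinearMap 𝕜 E F) :
    BddBelow {c : ℝ | ∃ lam x' y, IsSigmaRep p A lam x' y ∧
      c = ‖lam‖ * (sigmaTail p x' y 0).toReal} :=
  ⟨0, by rintro _ ⟨lam, x', y, -, rfl⟩
         exact mul_nonneg (lp.norm_nonneg' lam) ENNReal.toReal_nonneg⟩

theorem sigmaNorm_nonneg (p : ℝ) (A : ContinuousMultilinearMap 𝕜 E F) : 0 ≤ sigmaNorm p A :=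
  Real.sInf_nonneg (by rintro _ ⟨lam, x', y, -, rfl⟩
                       exact mul_nonneg (lp.norm_nonneg' lam) ENNReal.toReal_nonneg)

theorem sigmaNorm_le {p : ℝ} {A : ContinuousMultilinearMap 𝕜 E F}
    {lam : lp (fun _ : ℕ => 𝕜) (conjExp p)} {x' : ℕ → ∀ i, StrongDual 𝕜 (E i)} {y : ℕ → F}
    (h : IsSigmaRep p A lam x' y) : sigmaNorm p A ≤ ‖lam‖ * (sigmaTail p x' y 0).toReal :=
  csInf_le (sigmaNorm_bddBelow p A) ⟨lam, x', y, h, rfl⟩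

theorem exists_rep_lt {p : ℝ} {A : ContinuousMultilinearMap 𝕜 E F} (hA : IsSigmaNuclear p A)
    {b : ℝ} (hb : sigmaNorm p A < b) :
    ∃ lam x' y, IsSigmaRep p A lam x' y ∧ ‖lam‖ * (sigmaTail p x' y 0).toReal < b := by
  have hne : {c : ℝ | ∃ lam x' y, IsSigmaRep p A lam x' y ∧
      c = ‖lam‖ * (sigmaTail p x' y 0).toReal}.Nonempty := by
    obtain ⟨lam, x', y, h⟩ := hA
    exact ⟨_, lam, x', y, h, rfl⟩
  obtain ⟨_, ⟨lam, x', y, h, rfl⟩, hlt⟩ := exists_lt_of_csInf_lt hne hb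
  exact ⟨lam, x', y, h, hlt⟩

/-- Elementary tensors are `σ(p)`-nuclear. -/
theorem elemTensor_isSigmaNuclear {p : ℝ} (hp : 1 ≤ p) (x' : ∀ i, StrongDual 𝕜 (E i)) (y : F) :
    IsSigmaNuclear p (elemTensor x' y) := by
  have h0 : (0 : ℝ) < p := by linarith
  refine ⟨lp.single _ 0 1, fun _ => x', fun j => if j = 0 then y else 0, fun x => ?_, ?_, ?_⟩
  · refine tendsto_const_nhds.congr' ((Filter.eventually_ge_atTop 1).mono fun N hN => ?_)
    have hl : ∀ j, (lp.single (conjExp p) 0 (1 : 𝕜) : lp (fun _ : ℕ => 𝕜) (conjExp p)) j =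
        if j = 0 then 1 else 0 := by
      intro j
      rw [lp.coeFn_single, Pi.single_apply]
    simp only [hl]
    rw [Finset.sum_eq_single_of_mem 0 (Finset.mem_range.2 hN)]
    · simp
    · intro j _ hj
      simp [hj]
  · refine lt_of_le_of_lt (b := ENNReal.ofReal ((∏ i, ‖x' i‖) * ‖y‖)) ?_ ENNReal.ofReal_lt_top
    rw [sigmaTail_le_iff hp]
    intro x hx y' hy
    rw [tsum_subtype (Set.Ici 0)
      (fun j => ‖(∏ i, x' i (x i)) * y' (if j = 0 then y else 0)‖ₑ ^ p),
      tsum_eq_single 0 (by intro j hj; simp [hj, Set.indicator, h0])]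
    simp only [Set.indicator, Set.mem_Ici, le_refl, if_true]
    refine ENNReal.rpow_le_rpow ?_ h0.le
    rw [← ofReal_norm]
    refine ENNReal.ofReal_le_ofReal ?_
    rw [norm_mul, norm_prod]
    refine mul_le_mul (Finset.prod_le_prod (fun _ _ => norm_nonneg _) fun i _ => ?_) ?_
      (norm_nonneg _) (Finset.prod_nonneg fun _ _ => norm_nonneg _)
    · exact (x' i).unit_le_opNorm _ (hx i)
    · exact (y'.le_opNorm y).trans (mul_le_of_le_one_left (norm_nonneg _) hy)
  · refine tendsto_const_nhds.congr' ((Filter.eventually_ge_atTop 1).mono fun m hm => ?_)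
    symm
    rw [← nonpos_iff_eq_zero, sigmaTail_le_iff hp]
    intro x hx y' hy
    rw [ENNReal.zero_rpow_of_pos h0, nonpos_iff_eq_zero, ENNReal.tsum_eq_zero]
    rintro ⟨j, hj⟩
    have : j ≠ 0 := by have := Set.mem_Ici.1 hj; omega
    simp [this, h0]

variable (𝕜 E F) in
/-- The subspace of `σ(p)`-nuclear operators in the space of continuous `n`-linear operators. -/
def sigmaNuclearSubmodule (p : ℝ) [hp : Fact (1 ≤ p)] :
    Submodule 𝕜 (ContinuousMultilinearMap 𝕜 E F) where
  carrier := {A | IsSigmaNuclear p A}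
  add_mem' := by
    rintro A B ⟨l, x, y, h⟩ ⟨l', x', y', h'⟩
    exact ⟨_, _, _, h.add hp.out h'⟩
  zero_mem' := by
    have h := elemTensor_isSigmaNuclear hp.out (fun i => (0 : StrongDual 𝕜 (E i))) (0 : F)
    have e : elemTensor (fun i => (0 : StrongDual 𝕜 (E i))) (0 : F) = 0 := by ext; simp
    rwa [e] at h
  smul_mem' := by
    rintro c A ⟨l, x, y, h⟩
    exact ⟨_, _, _, h.smul c⟩

variable (𝕜 E F) in
/-- The space `L_{σ(p)}(E₁, …, Eₙ; F)`; below it is given the norm `‖·‖_{σ(p)}`, and not the norm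
of the space of all continuous `n`-linear operators. -/
def SigmaNuclear (p : ℝ) [Fact (1 ≤ p)] : Type _ := sigmaNuclearSubmodule 𝕜 E F p

namespace SigmaNuclear

variable {p : ℝ} [hp : Fact (1 ≤ p)]

instance : AddCommGroup (SigmaNuclear 𝕜 E F p) :=
  inferInstanceAs (AddCommGroup (sigmaNuclearSubmodule 𝕜 E F p))

instance : Module 𝕜 (SigmaNuclear 𝕜 E F p) :=
  inferInstanceAs (Module 𝕜 (sigmaNuclearSubmodule 𝕜 E F p))

/-- The inclusion in the space of all continuous `n`-linear operators. -/
def toCMM : SigmaNuclear 𝕜 E F p →ₗ[𝕜] ContinuousMultilinearMap 𝕜 E F :=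
  (sigmaNuclearSubmodule 𝕜 E F p).subtype

theorem toCMM_injective : Function.Injective (toCMM : SigmaNuclear 𝕜 E F p → _) :=
  Subtype.val_injective

theorem isSigmaNuclear (A : SigmaNuclear 𝕜 E F p) : IsSigmaNuclear p (toCMM A) := A.2

variable (p) in
/-- `x'₁ ⊗ ⋯ ⊗ x'ₙ ⊗ y` as an element of `L_{σ(p)}(E₁, …, Eₙ; F)`. -/
def tensor (x' : ∀ i, StrongDual 𝕜 (E i)) (y : F) : SigmaNuclear 𝕜 E F p :=
  ⟨elemTensor x' y, elemTensor_isSigmaNuclear hp.out x' y⟩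

theorem sigmaNorm_smul_le (c : 𝕜) (A : SigmaNuclear 𝕜 E F p) :
    sigmaNorm p (toCMM (c • A)) ≤ ‖c‖ * sigmaNorm p (toCMM A) := by
  refine le_of_forall_pos_le_add fun ε hε => ?_
  obtain ⟨l, x, y, h, hlt⟩ := exists_rep_lt A.isSigmaNuclear
    (lt_add_of_pos_right (sigmaNorm p (toCMM A)) (show 0 < ε / (‖c‖ + 1) by positivity))
  have h1 := sigmaNorm_le (h.smul c)
  rw [lp.norm_const_smul (conjExp_ne_zero hp.out), mul_assoc] at h1
  rw [map_smul]
  refine h1.trans ((mul_le_mul_of_nonneg_left hlt.le (norm_nonneg c)).trans ?_)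
  rw [mul_add]
  gcongr
  rw [mul_div_assoc', div_le_iff₀ (by positivity)]
  nlinarith

theorem sigmaNorm_add_le (A B : SigmaNuclear 𝕜 E F p) :
    sigmaNorm p (toCMM (A + B)) ≤ sigmaNorm p (toCMM A) + sigmaNorm p (toCMM B) := by
  refine le_of_forall_pos_le_add fun ε hε => ?_
  have hp0 : 0 < p := by linarith [hp.out]
  set a := sigmaNorm p (toCMM A) + ε / 2 with ha
  set b := sigmaNorm p (toCMM B) + ε / 2 with hb
  have ha0 : 0 < a := by have := sigmaNorm_nonneg p (toCMM A); positivity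
  have hb0 : 0 < b := by have := sigmaNorm_nonneg p (toCMM B); positivity
  obtain ⟨l, x, y, h, hlt⟩ := exists_rep_lt A.isSigmaNuclear (b := a) (by linarith)
  obtain ⟨l', x', y', h', hlt'⟩ := exists_rep_lt B.isSigmaNuclear (b := b) (by linarith)
  obtain ⟨m, z, hr, hm, hz⟩ := h.normalize hp.out ha0 hlt.le
  obtain ⟨m', z', hr', hm', hz'⟩ := h'.normalize hp.out hb0 hlt'.le
  have hs := hr.add hp.out hr'
  rw [map_add]
  refine (sigmaNorm_le hs).trans ?_
  have h1 := norm_interleave_le hp.out m m' ha0 hb0 hm hm'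
  have h2 : (sigmaTail p (interleave x x') (interleave z z') 0).toReal ≤ (a + b) ^ (1 / p) := by
    refine ENNReal.toReal_le_of_le_ofReal (by positivity) ?_
    refine (sigmaTail_interleave hp.out x x' z z' (k := 0) (by simp)).trans ?_
    rw [← ENNReal.ofReal_rpow_of_nonneg (by positivity) (by positivity)]
    refine ENNReal.rpow_le_rpow ?_ (by positivity)
    rw [ENNReal.ofReal_add ha0.le hb0.le]
    have key : ∀ {c : ℝ} {w : ℝ≥0∞}, 0 < c → w ≤ ENNReal.ofReal (c ^ (1 / p)) →
        w ^ p ≤ ENNReal.ofReal c := by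
      intro c w hc hw
      refine (ENNReal.rpow_le_rpow hw hp0.le).trans (le_of_eq ?_)
      rw [ENNReal.ofReal_rpow_of_nonneg (by positivity) hp0.le, one_div,
        Real.rpow_inv_rpow hc.le hp0.ne']
    exact add_le_add (key ha0 hz) (key hb0 hz')
  refine (mul_le_mul h1 h2 ENNReal.toReal_nonneg (by positivity)).trans (le_of_eq ?_)
  rw [← Real.rpow_add (by positivity), add_comm (1 / _), conjExp_add hp.out, Real.rpow_one]
  rw [ha, hb]
  ring

theorem eq_zero_of_sigmaNorm (A : SigmaNuclear 𝕜 E F p) (h : sigmaNorm p (toCMM A) = 0) :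
    A = 0 := by
  apply toCMM_injective
  rw [map_zero]
  have key : ∀ x : ∀ i, E i, (∀ i, ‖x i‖ ≤ 1) → toCMM A x = 0 := by
    intro x hx
    rw [← norm_le_zero_iff]
    refine le_of_forall_pos_le_add fun ε hε => ?_
    obtain ⟨l, x', y, hr, hlt⟩ := exists_rep_lt A.isSigmaNuclear (b := 0 + ε) (by linarith)
    exact (hr.norm_apply_le hp.out hx).trans hlt.le
  ext x
  have hpos : ∀ i, 0 < 1 + ‖x i‖ := fun i => by positivity
  have h1 := key (fun i => (((1 + ‖x i‖)⁻¹ : ℝ) : 𝕜) • x i) fun i => by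
    rw [norm_smul, RCLike.norm_ofReal, abs_of_pos (inv_pos.2 (hpos i)),
      inv_mul_le_iff₀ (hpos i)]
    linarith
  rw [ContinuousMultilinearMap.map_smul_univ] at h1
  refine (smul_eq_zero.1 h1).resolve_left (Finset.prod_ne_zero_iff.2 fun i _ => ?_)
  exact_mod_cast (inv_pos.2 (hpos i)).ne'

/-- `‖·‖_{σ(p)}` is a norm on `L_{σ(p)}(E₁, …, Eₙ; F)`. -/
def addGroupNorm : AddGroupNorm (SigmaNuclear 𝕜 E F p) where
  toFun A := sigmaNorm p (toCMM A)
  map_zero' := le_antisymm (by simpa using sigmaNorm_smul_le (0 : 𝕜) (0 : SigmaNuclear 𝕜 E F p))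
    (sigmaNorm_nonneg _ _)
  add_le' := sigmaNorm_add_le
  neg' A := le_antisymm (by simpa using sigmaNorm_smul_le (-1 : 𝕜) A)
    (by simpa using sigmaNorm_smul_le (-1 : 𝕜) (-A))
  eq_zero_of_map_eq_zero' := eq_zero_of_sigmaNorm

instance : NormedAddCommGroup (SigmaNuclear 𝕜 E F p) :=
  addGroupNorm.toNormedAddCommGroup

theorem norm_def (A : SigmaNuclear 𝕜 E F p) : ‖A‖ = sigmaNorm p (toCMM A) := rfl

instance : NormedSpace 𝕜 (SigmaNuclear 𝕜 E F p) where
  norm_smul_le := sigmaNorm_smul_le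

end SigmaNuclear

end SigmaNuclear

/-! ### `τ(p)`-summing operators -/

section TauSumming

variable {𝕜 : Type*} [RCLike 𝕜] {n : ℕ} {E : Fin n → Type*} {G : Type*}
  [∀ i, NormedAddCommGroup (E i)] [∀ i, NormedSpace 𝕜 (E i)]
  [NormedAddCommGroup G] [NormedSpace 𝕜 G]

/-- `sup (∑ⱼ |x'₁(x₁ⱼ) ⋯ x'ₙ(xₙⱼ) b'ⱼ(y)|^p)^{1/p}` for finitely many `(x₁ⱼ, …, xₙⱼ)` and `b'ⱼ`
in `G'`, the supremum being over `x'ᵢ` in the closed unit ball of `Eᵢ'` and `y` in the closed unit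
ball of `G`. (The set is bounded, so this is a true supremum.) -/
def tauSup (p : ℝ) {m : ℕ} (x : Fin m → ∀ i, E i) (b' : Fin m → StrongDual 𝕜 G) : ℝ :=
  sSup {c : ℝ | ∃ (x' : ∀ i, StrongDual 𝕜 (E i)) (y : G), (∀ i, ‖x' i‖ ≤ 1) ∧ ‖y‖ ≤ 1 ∧
    c = (∑ j, ‖(∏ i, x' i (x j i)) * b' j y‖ ^ p) ^ (1 / p)}

/-- `C ≥ 0` is an admissible constant in the definition of `τ(p)`-summing operators. -/
def IsTauBound (p : ℝ) (S : ContinuousMultilinearMap 𝕜 E G) (C : ℝ) : Prop :=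
  0 ≤ C ∧ ∀ (m : ℕ) (x : Fin m → ∀ i, E i) (b' : Fin m → StrongDual 𝕜 G),
    (∑ j, ‖b' j (S (x j))‖ ^ p) ^ (1 / p) ≤ C * tauSup p x b'

/-- `S` is `τ(p)`-summing. -/
def IsTauSumming (p : ℝ) (S : ContinuousMultilinearMap 𝕜 E G) : Prop :=
  ∃ C, IsTauBound p S C

/-- `‖S‖_{τ(p)}`, the infimum of the admissible constants. -/
def tauNorm (p : ℝ) (S : ContinuousMultilinearMap 𝕜 E G) : ℝ :=
  sInf {C : ℝ | IsTauBound p S C}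

/-! The next lemmas show that the `τ(p)`-summing operators form a normed space. -/

theorem tauSup_nonneg (p : ℝ) {m : ℕ} (x : Fin m → ∀ i, E i) (b' : Fin m → StrongDual 𝕜 G) :
    0 ≤ tauSup p x b' :=
  Real.sSup_nonneg (by rintro _ ⟨x', y, -, -, rfl⟩; positivity)

theorem tauSup_bddAbove {p : ℝ} (hp : 1 ≤ p) {m : ℕ} (x : Fin m → ∀ i, E i)
    (b' : Fin m → StrongDual 𝕜 G) :
    BddAbove {c : ℝ | ∃ (x' : ∀ i, StrongDual 𝕜 (E i)) (y : G), (∀ i, ‖x' i‖ ≤ 1) ∧ ‖y‖ ≤ 1 ∧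
      c = (∑ j, ‖(∏ i, x' i (x j i)) * b' j y‖ ^ p) ^ (1 / p)} := by
  refine ⟨(∑ j, ((∏ i, ‖x j i‖) * ‖b' j‖) ^ p) ^ (1 / p), ?_⟩
  rintro _ ⟨x', y, hx', hy, rfl⟩
  have h0 : (0 : ℝ) ≤ p := by linarith
  refine Real.rpow_le_rpow (by positivity) (Finset.sum_le_sum fun j _ => ?_) (by positivity)
  refine Real.rpow_le_rpow (norm_nonneg _) ?_ h0
  rw [norm_mul, norm_prod]
  refine mul_le_mul (Finset.prod_le_prod (fun _ _ => norm_nonneg _) fun i _ => ?_) ?_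
    (norm_nonneg _) (Finset.prod_nonneg fun _ _ => norm_nonneg _)
  · exact ((x' i).le_opNorm _).trans (mul_le_of_le_one_left (norm_nonneg _) (hx' i))
  · exact (b' j).unit_le_opNorm _ hy

theorem IsTauBound.add {p : ℝ} (hp : 1 ≤ p) {S T : ContinuousMultilinearMap 𝕜 E G} {C D : ℝ}
    (hS : IsTauBound p S C) (hT : IsTauBound p T D) : IsTauBound p (S + T) (C + D) := by
  refine ⟨add_nonneg hS.1 hT.1, fun m x b' => ?_⟩
  have h0 : (0 : ℝ) ≤ p := by linarith
  rw [add_mul]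
  refine le_trans ?_ (add_le_add (hS.2 m x b') (hT.2 m x b'))
  refine le_trans ?_ (Real.Lp_add_le_of_nonneg Finset.univ hp (fun _ _ => norm_nonneg _)
    (fun _ _ => norm_nonneg _))
  refine Real.rpow_le_rpow (by positivity) (Finset.sum_le_sum fun j _ => ?_) (by positivity)
  refine Real.rpow_le_rpow (norm_nonneg _) ?_ h0
  simpa using norm_add_le (b' j (S (x j))) (b' j (T (x j)))

theorem IsTauBound.smul {p : ℝ} (hp : 1 ≤ p) {S : ContinuousMultilinearMap 𝕜 E G} {C : ℝ}
    (hS : IsTauBound p S C) (c : 𝕜) : IsTauBound p (c • S) (‖c‖ * C) := by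
  refine ⟨mul_nonneg (norm_nonneg _) hS.1, fun m x b' => ?_⟩
  have h0 : (0 : ℝ) < p := by linarith
  rw [mul_assoc]
  refine le_trans (le_of_eq ?_) (mul_le_mul_of_nonneg_left (hS.2 m x b') (norm_nonneg c))
  simp only [smul_apply, map_smul, norm_smul]
  simp only [Real.mul_rpow (norm_nonneg _) (norm_nonneg _), ← Finset.mul_sum]
  rw [Real.mul_rpow (by positivity) (by positivity), one_div,
    Real.rpow_rpow_inv (norm_nonneg _) h0.ne']

theorem tauNorm_nonneg (p : ℝ) (S : ContinuousMultilinearMap 𝕜 E G) : 0 ≤ tauNorm p S :=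
  Real.sInf_nonneg fun _ h => h.1

theorem tauNorm_le {p : ℝ} {S : ContinuousMultilinearMap 𝕜 E G} {C : ℝ} (h : IsTauBound p S C) :
    tauNorm p S ≤ C :=
  csInf_le ⟨0, fun _ h => h.1⟩ h

theorem IsTauSumming.isTauBound {p : ℝ} {S : ContinuousMultilinearMap 𝕜 E G}
    (h : IsTauSumming p S) : IsTauBound p S (tauNorm p S) := by
  refine ⟨tauNorm_nonneg p S, fun m x b' => ?_⟩
  refine le_of_forall_pos_le_add fun ε hε => ?_
  have ht := tauSup_nonneg p x b'
  obtain ⟨C, hC, hlt⟩ := exists_lt_of_csInf_lt h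
    (show tauNorm p S < tauNorm p S + ε / (tauSup p x b' + 1) from
      lt_add_of_pos_right _ (by positivity))
  refine (hC.2 m x b').trans ((mul_le_mul_of_nonneg_right hlt.le ht).trans ?_)
  rw [add_mul]
  gcongr
  rw [div_mul_eq_mul_div, div_le_iff₀ (by positivity)]
  nlinarith

theorem isTauBound_zero {p : ℝ} (hp : 1 ≤ p) :
    IsTauBound p (0 : ContinuousMultilinearMap 𝕜 E G) 0 := by
  refine ⟨le_rfl, fun m x b' => ?_⟩
  have h0 : p ≠ 0 := by linarith
  simp [Real.zero_rpow h0, Real.zero_rpow (inv_ne_zero h0)]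

variable (𝕜 E G) in
/-- The subspace of `τ(p)`-summing operators in the space of continuous `n`-linear operators. -/
def tauSummingSubmodule (p : ℝ) [hp : Fact (1 ≤ p)] :
    Submodule 𝕜 (ContinuousMultilinearMap 𝕜 E G) where
  carrier := {S | IsTauSumming p S}
  add_mem' := by
    rintro S T ⟨C, hC⟩ ⟨D, hD⟩
    exact ⟨_, hC.add hp.out hD⟩
  zero_mem' := ⟨0, isTauBound_zero hp.out⟩
  smul_mem' := by
    rintro c S ⟨C, hC⟩
    exact ⟨_, hC.smul hp.out c⟩

variable (𝕜 E G) in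
/-- The space `L_{τ(p)}(E₁, …, Eₙ; G)`; below it is given the norm `‖·‖_{τ(p)}`, and not the norm
of the space of all continuous `n`-linear operators. -/
def TauSumming (p : ℝ) [Fact (1 ≤ p)] : Type _ := tauSummingSubmodule 𝕜 E G p

namespace TauSumming

variable {p : ℝ} [hp : Fact (1 ≤ p)]

instance : AddCommGroup (TauSumming 𝕜 E G p) :=
  inferInstanceAs (AddCommGroup (tauSummingSubmodule 𝕜 E G p))

instance : Module 𝕜 (TauSumming 𝕜 E G p) :=
  inferInstanceAs (Module 𝕜 (tauSummingSubmodule 𝕜 E G p))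

/-- The inclusion in the space of all continuous `n`-linear operators. -/
def toCMM : TauSumming 𝕜 E G p →ₗ[𝕜] ContinuousMultilinearMap 𝕜 E G :=
  (tauSummingSubmodule 𝕜 E G p).subtype

theorem toCMM_injective : Function.Injective (toCMM : TauSumming 𝕜 E G p → _) :=
  Subtype.val_injective

theorem isTauSumming (S : TauSumming 𝕜 E G p) : IsTauSumming p (toCMM S) := S.2

theorem tauNorm_smul_le (c : 𝕜) (S : TauSumming 𝕜 E G p) :
    tauNorm p (toCMM (c • S)) ≤ ‖c‖ * tauNorm p (toCMM S) := by
  rw [map_smul]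
  exact tauNorm_le (S.isTauSumming.isTauBound.smul hp.out c)

theorem eq_zero_of_tauNorm (S : TauSumming 𝕜 E G p) (h : tauNorm p (toCMM S) = 0) : S = 0 := by
  apply toCMM_injective
  rw [map_zero]
  ext x
  have hp0 : 0 < p := by linarith [hp.out]
  obtain ⟨g, -, hgx⟩ := exists_dual_vector'' 𝕜 (toCMM S x)
  have h1 := S.isTauSumming.isTauBound.2 1 (fun _ => x) (fun _ => g)
  rw [h, zero_mul] at h1
  simp only [Finset.univ_unique, Finset.sum_singleton, one_div, hgx, RCLike.norm_ofReal, abs_norm,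
    Real.rpow_rpow_inv (norm_nonneg _) hp0.ne'] at h1
  exact norm_le_zero_iff.1 h1

/-- `‖·‖_{τ(p)}` is a norm on `L_{τ(p)}(E₁, …, Eₙ; G)`. -/
def addGroupNorm : AddGroupNorm (TauSumming 𝕜 E G p) where
  toFun S := tauNorm p (toCMM S)
  map_zero' := le_antisymm (by simpa using tauNorm_smul_le (0 : 𝕜) (0 : TauSumming 𝕜 E G p))
    (tauNorm_nonneg _ _)
  add_le' S T := by
    rw [map_add]
    exact tauNorm_le (S.isTauSumming.isTauBound.add hp.out T.isTauSumming.isTauBound)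
  neg' S := le_antisymm (by simpa using tauNorm_smul_le (-1 : 𝕜) S)
    (by simpa using tauNorm_smul_le (-1 : 𝕜) (-S))
  eq_zero_of_map_eq_zero' := eq_zero_of_tauNorm

instance : NormedAddCommGroup (TauSumming 𝕜 E G p) :=
  addGroupNorm.toNormedAddCommGroup

theorem norm_def (S : TauSumming 𝕜 E G p) : ‖S‖ = tauNorm p (toCMM S) := rfl

instance : NormedSpace 𝕜 (TauSumming 𝕜 E G p) where
  norm_smul_le := tauNorm_smul_le

end TauSumming

end TauSumming

end

open scoped ENNReal Topology

noncomputable section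

/-! ### Goldstine's theorem -/

section Goldstine

variable {𝕜 : Type*} [RCLike 𝕜]

/-! A functional `φ` on the nuclear operators and a `τ(p)`-summing `S` determine each other through
a trace: `φ (∑ λ_j x'_j ⊗ y_j) = ∑ λ_j S(x'_j)(y_j)`.

From `φ` to `S`: the `ℓ_p`-norm of the numbers `φ (x'_j ⊗ y_j)` is attained against some `λ` in the
unit ball of `ℓ_{p'}` (`exists_lp_dual`), so it is the value of `φ` at a finite nuclear operator,
whose norm is at most the weak supremum of the `x'_j ⊗ y_j`. Hence `‖φ‖` is an admissible constant
for the Borel transform (`isTauBound_borelForm`); reflexivity turns the functionals on `F'` in the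
summing inequality into points of `F`. Conversely, `w_m → 0` makes every representation converge in
the nuclear norm, so `φ` is the trace of its own Borel transform, and Hölder bounds that trace by
any admissible constant (`norm_le_of_isTauBound_borelForm`). This gives an isometry without any
approximation property.

Onto: the trace of `S` must not depend on the representation, i.e. it must vanish along
representations of `0` (`IsTauBound.tendsto_zero`). Precompose `S` with finite rank operators `T_i`
on the `E_i'`. The trace becomes a finite combination of sums `∑ λ_j x''_1(x'_1j) ⋯ x''_n(x'_nj)
y'(y_j)`. These vanish for `x''_i` in `E_i`, and Goldstine's theorem carries the resulting bound on
partial sums to the biduals (`IsSigmaRep.norm_sum_bidual_le`). The terms from `N` on contribute at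
most `‖λ‖ C ∏ ‖T_i‖ w_N`, uniformly for `‖T_i‖ ≤ γ_i`; as the whole trace is zero, the `N`-th
partial sum obeys the same bound. Letting `T_i → id` on the finitely many functionals involved
removes the `T_i`, and `w_N → 0`. -/

theorem exists_unit_smul {X : Type*} [NormedAddCommGroup X] [NormedSpace 𝕜 X] (v : X) :
    ∃ u : X, ‖u‖ ≤ 1 ∧ v = (‖v‖ : 𝕜) • u := by
  rcases eq_or_ne v 0 with rfl | hv
  · exact ⟨0, by simp, by simp⟩
  · have hv' : (‖v‖ : 𝕜) ≠ 0 := by exact_mod_cast norm_ne_zero_iff.2 hv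
    refine ⟨((‖v‖ : 𝕜)⁻¹) • v, ?_, by rw [smul_inv_smul₀ hv']⟩
    rw [norm_smul, norm_inv, RCLike.norm_ofReal, abs_norm,
      inv_mul_cancel₀ (norm_ne_zero_iff.2 hv)]

/-- The unit ball is stable under multiplication by unimodular scalars, so each value of `h` can be
rotated onto the nonnegative real axis. This turns the real-part bound given by Hahn–Banach
separation into a norm bound. -/
theorem norm_le_of_re_le {X : Type*} [NormedAddCommGroup X] [NormedSpace 𝕜 X]
    {h : StrongDual 𝕜 X} {u : ℝ} (hu : ∀ x, ‖x‖ ≤ 1 → RCLike.re (h x) ≤ u) : ‖h‖ ≤ u := by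
  have hu0 : 0 ≤ u := by simpa using hu 0 (by simp)
  refine h.opNorm_le_bound hu0 fun x => ?_
  obtain ⟨v, hv, hxv⟩ := exists_unit_smul (𝕜 := 𝕜) x
  obtain ⟨c, hc, hcv⟩ := RCLike.exists_norm_eq_mul_self (h v)
  have h1 := hu (c • v) (by rw [norm_smul, hc, one_mul]; exact hv)
  rw [map_smul, smul_eq_mul, ← hcv, RCLike.ofReal_re] at h1
  have h2 : ‖h x‖ = ‖x‖ * ‖h v‖ := by
    conv_lhs => rw [hxv]
    rw [map_smul, norm_smul, RCLike.norm_ofReal, abs_norm]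
  rw [h2, mul_comm]
  exact mul_le_mul_of_nonneg_right h1 (norm_nonneg x)

/-- Goldstine's theorem, for finitely many functionals. -/
theorem goldstine_finite {X ι : Type*} [NormedAddCommGroup X] [NormedSpace 𝕜 X] [Fintype ι]
    (f : ι → StrongDual 𝕜 X) {g : StrongDual 𝕜 (StrongDual 𝕜 X)} (hg : ‖g‖ ≤ 1) :
    (fun i => g (f i)) ∈ closure ((fun (x : X) i => f i x) '' Metric.closedBall 0 1) := by
  classical
  by_contra hmem
  have hconv : Convex ℝ ((fun (x : X) i => f i x) '' Metric.closedBall 0 1) := by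
    rintro _ ⟨x, hx, rfl⟩ _ ⟨y, hy, rfl⟩ a b ha hb hab
    refine ⟨(a : 𝕜) • x + (b : 𝕜) • y, ?_, ?_⟩
    · rw [mem_closedBall_zero_iff] at *
      refine (norm_add_le _ _).trans ?_
      rw [norm_smul, norm_smul, RCLike.norm_ofReal, RCLike.norm_ofReal, abs_of_nonneg ha,
        abs_of_nonneg hb, ← hab]
      exact add_le_add (mul_le_of_le_one_right ha hx) (mul_le_of_le_one_right hb hy)
    · ext i
      simp [RCLike.real_smul_eq_coe_mul]
  -- The separating functional on the finite product is a combination of coordinates; pulled back to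
  -- `X` it is the combination `h` of the `f i`, with `‖h‖ ≤ u < re (g h)`, against `‖g‖ ≤ 1`.
  obtain ⟨l, u, hl, hlu⟩ := RCLike.geometric_hahn_banach_closed_point (𝕜 := 𝕜) hconv.closure
    isClosed_closure hmem
  have hexp : ∀ v : ι → 𝕜, l v = ∑ i, v i * l (Pi.single i 1) := by
    intro v
    conv_lhs => rw [pi_eq_sum_univ' v, map_sum]
    refine Finset.sum_congr rfl fun i _ => ?_
    rw [map_smul, smul_eq_mul]
  set h : StrongDual 𝕜 X := ∑ i, l (Pi.single i 1) • f i with hh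
  have hnorm : ‖h‖ ≤ u := norm_le_of_re_le fun x hx => by
    have := hl _ (subset_closure ⟨x, mem_closedBall_zero_iff.2 hx, rfl⟩)
    rw [hexp] at this
    simp only [hh, sum_apply, smul_apply, smul_eq_mul]
    simpa only [mul_comm] using this.le
  have hgh : l (fun i => g (f i)) = g h := by
    rw [hexp, hh, map_sum]
    refine Finset.sum_congr rfl fun i _ => ?_
    rw [map_smul, smul_eq_mul, mul_comm]
  rw [hgh] at hlu
  have h1 : ‖g h‖ ≤ ‖h‖ := (g.le_opNorm h).trans (mul_le_of_le_one_left (norm_nonneg _) hg)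
  linarith [RCLike.re_le_norm (g h)]

/-- Goldstine's theorem, for a sequence of functionals. -/
theorem goldstine_seq {X : Type*} [NormedAddCommGroup X] [NormedSpace 𝕜 X]
    (f : ℕ → StrongDual 𝕜 X) (g : StrongDual 𝕜 (StrongDual 𝕜 X)) :
    ∃ u : ℕ → X, (∀ k, ‖u k‖ ≤ ‖g‖) ∧
      ∀ j, Filter.Tendsto (fun k => f j (u k)) Filter.atTop (𝓝 (g (f j))) := by
  obtain ⟨g₁, hg₁, hg⟩ := exists_unit_smul (𝕜 := 𝕜) g
  -- The `k`-th point handles only the first `k` functionals, with error `1 / (k + 1)`; every fixed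
  -- functional is eventually covered.
  have key : ∀ k : ℕ, ∃ x : X, ‖x‖ ≤ 1 ∧ ∀ j < k, dist (g₁ (f j)) (f j x) < 1 / ((k : ℝ) + 1) := by
    intro k
    obtain ⟨_, ⟨x, hx, rfl⟩, hd⟩ := Metric.mem_closure_iff.1
      (goldstine_finite (fun j : Fin k => f j) hg₁) (1 / ((k : ℝ) + 1)) Nat.one_div_pos_of_nat
    exact ⟨x, mem_closedBall_zero_iff.1 hx, fun j hj => (dist_le_pi_dist _ _ ⟨j, hj⟩).trans_lt hd⟩
  choose v hv hvd using key
  refine ⟨fun k => (‖g‖ : 𝕜) • v k, fun k => ?_, fun j => ?_⟩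
  · rw [norm_smul, RCLike.norm_ofReal, abs_of_nonneg (norm_nonneg g)]
    exact mul_le_of_le_one_right (norm_nonneg _) (hv k)
  · have h1 : Filter.Tendsto (fun k => f j (v k)) Filter.atTop (𝓝 (g₁ (f j))) := by
      rw [tendsto_iff_dist_tendsto_zero]
      refine squeeze_zero' (.of_forall fun _ => dist_nonneg) ?_
        (tendsto_one_div_add_atTop_nhds_zero_nat (𝕜 := ℝ))
      filter_upwards [Filter.eventually_gt_atTop j] with k hk
      rw [dist_comm]
      exact (hvd k j hk).le
    have h2 := h1.const_mul (‖g‖ : 𝕜)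
    have h3 : g (f j) = (‖g‖ : 𝕜) * g₁ (f j) := by
      conv_lhs => rw [hg]
      rfl
    rw [h3]
    simpa using h2

end Goldstine

/-! ### Estimates for `σ(p)`-nuclear representations -/

section Estimates

variable {𝕜 : Type*} [RCLike 𝕜] {n : ℕ} {E : Fin n → Type*} {F : Type*}
  [∀ i, NormedAddCommGroup (E i)] [∀ i, NormedSpace 𝕜 (E i)]
  [NormedAddCommGroup F] [NormedSpace 𝕜 F]
  {p : ℝ} {x' : ℕ → ∀ i, StrongDual 𝕜 (E i)} {y : ℕ → F}

theorem sigmaTail_anti (hp : 1 ≤ p) (x' : ℕ → ∀ i, StrongDual 𝕜 (E i)) (y : ℕ → F) {k m : ℕ}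
    (h : k ≤ m) : sigmaTail p x' y m ≤ sigmaTail p x' y k := by
  rw [sigmaTail_le_iff hp]
  intro x hx y' hy
  exact (ENNReal.tsum_mono_subtype (fun j => ‖(∏ i, x' j i (x i)) * y' (y j)‖ₑ ^ p)
    (Set.Ici_subset_Ici.2 h)).trans (le_sigmaTail hp x' y k hx hy)

theorem lp_sum_le_sigmaTail_of_unit (hp : 1 ≤ p) {m : ℕ} (hfin : sigmaTail p x' y m ≠ ∞)
    {s : Finset ℕ} (hs : ∀ j ∈ s, m ≤ j) {x : ∀ i, E i} (hx : ∀ i, ‖x i‖ ≤ 1)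
    {y' : StrongDual 𝕜 F} (hy : ‖y'‖ ≤ 1) :
    (∑ j ∈ s, ‖(∏ i, x' j i (x i)) * y' (y j)‖ ^ p) ^ (1 / p) ≤ (sigmaTail p x' y m).toReal := by
  have h0 : (0 : ℝ) < p := by linarith
  rw [one_div, Real.rpow_inv_le_iff_of_pos (by positivity) ENNReal.toReal_nonneg h0,
    ENNReal.toReal_rpow]
  have h1 := le_sigmaTail hp x' y m hx hy
  have hfin' := ENNReal.rpow_lt_top_of_nonneg h0.le hfin
  rw [← ENNReal.ofReal_le_iff_le_toReal hfin'.ne]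
  refine le_trans ?_ h1
  rw [tsum_subtype (Set.Ici m) (fun j => ‖(∏ i, x' j i (x i)) * y' (y j)‖ₑ ^ p)]
  refine le_trans (le_of_eq ?_) (ENNReal.sum_le_tsum s)
  rw [ENNReal.ofReal_sum_of_nonneg fun _ _ => by positivity]
  refine Finset.sum_congr rfl fun j hj => ?_
  rw [← ENNReal.ofReal_rpow_of_nonneg (norm_nonneg _) h0.le, ofReal_norm]
  simp [Set.indicator, hs j hj]

theorem lp_sum_const_mul {ι : Type*} (hp : 1 ≤ p) (s : Finset ι) (c : 𝕜) (a : ι → 𝕜) :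
    (∑ j ∈ s, ‖c * a j‖ ^ p) ^ (1 / p) = ‖c‖ * (∑ j ∈ s, ‖a j‖ ^ p) ^ (1 / p) := by
  have h0 : (0 : ℝ) < p := by linarith
  simp only [norm_mul, Real.mul_rpow (norm_nonneg _) (norm_nonneg _), ← Finset.mul_sum]
  rw [Real.mul_rpow (by positivity) (by positivity), one_div,
    Real.rpow_rpow_inv (norm_nonneg _) h0.ne']

/-- Homogeneity in each variable reduces this to unit balls; writing a vector as its norm times a
point of the ball avoids treating zero vectors separately. -/
theorem lp_sum_le_sigmaTail (hp : 1 ≤ p) {m : ℕ} (hfin : sigmaTail p x' y m ≠ ∞)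
    {s : Finset ℕ} (hs : ∀ j ∈ s, m ≤ j) (x : ∀ i, E i) (y' : StrongDual 𝕜 F) :
    (∑ j ∈ s, ‖(∏ i, x' j i (x i)) * y' (y j)‖ ^ p) ^ (1 / p) ≤
      (∏ i, ‖x i‖) * ‖y'‖ * (sigmaTail p x' y m).toReal := by
  choose u hu hxu using fun i => exists_unit_smul (𝕜 := 𝕜) (x i)
  obtain ⟨v, hv, hyv⟩ := exists_unit_smul (𝕜 := 𝕜) y'
  have e : ∀ j, (∏ i, x' j i (x i)) * y' (y j) =
      ((∏ i, (‖x i‖ : 𝕜)) * (‖y'‖ : 𝕜)) * ((∏ i, x' j i (u i)) * v (y j)) := by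
    intro j
    have e1 : ∀ i, x' j i (x i) = (‖x i‖ : 𝕜) * x' j i (u i) := fun i => by
      conv_lhs => rw [hxu i, map_smul, smul_eq_mul]
    have e2 : y' (y j) = (‖y'‖ : 𝕜) * v (y j) := by
      conv_lhs => rw [hyv]
      rfl
    simp only [e1, e2, Finset.prod_mul_distrib]
    ring
  simp only [e]
  rw [lp_sum_const_mul hp, norm_mul, norm_prod]
  simp only [RCLike.norm_ofReal, abs_norm]
  exact mul_le_mul_of_nonneg_left (lp_sum_le_sigmaTail_of_unit hp hfin hs hu hv) (by positivity)

/-- Continuous expressions in the values of the functionals `x' j i` that are bounded on the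
product of balls of radius `‖x'' i‖` are bounded by the same constant at `x''`. -/
theorem le_of_goldstine (x' : ℕ → ∀ i, StrongDual 𝕜 (E i))
    (x'' : ∀ i, StrongDual 𝕜 (StrongDual 𝕜 (E i))) {Φ : (ℕ → 𝕜) → ℝ} (hΦ : Continuous Φ) {c : ℝ}
    (h : ∀ x : ∀ i, E i, (∀ i, ‖x i‖ ≤ ‖x'' i‖) → Φ (fun j => ∏ i, x' j i (x i)) ≤ c) :
    Φ (fun j => ∏ i, x'' i (x' j i)) ≤ c := by
  choose u hu hlim using fun i => goldstine_seq (fun j => x' j i) (x'' i)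
  have h1 : Filter.Tendsto (fun k j => ∏ i, x' j i (u i k)) Filter.atTop
      (𝓝 fun j => ∏ i, x'' i (x' j i)) :=
    tendsto_pi_nhds.2 fun j => tendsto_finsetProd _ fun i _ => hlim i j
  exact le_of_tendsto' ((hΦ.tendsto _).comp h1) fun k => h (fun i => u i k) fun i => hu i k

/-- A finite sum involves finitely many functionals, so Goldstine's theorem extends the bound from
`E i` to its bidual. This is needed because the summing inequality for `S` tests the `x' j i`
against all of the bidual ball. -/
theorem lp_sum_bidual_le_sigmaTail (hp : 1 ≤ p) {m : ℕ} (hfin : sigmaTail p x' y m ≠ ∞)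
    {s : Finset ℕ} (hs : ∀ j ∈ s, m ≤ j) (x'' : ∀ i, StrongDual 𝕜 (StrongDual 𝕜 (E i)))
    (y' : StrongDual 𝕜 F) :
    (∑ j ∈ s, ‖(∏ i, x'' i (x' j i)) * y' (y j)‖ ^ p) ^ (1 / p) ≤
      (∏ i, ‖x'' i‖) * ‖y'‖ * (sigmaTail p x' y m).toReal := by
  have h0 : (0 : ℝ) < p := by linarith
  refine le_of_goldstine x' x'' (Φ := fun a => (∑ j ∈ s, ‖a j * y' (y j)‖ ^ p) ^ (1 / p)) ?_ ?_
  · refine Continuous.rpow_const (continuous_finsetSum _ fun j _ => ?_) fun _ => .inr (by positivity)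
    exact Continuous.rpow_const (by fun_prop) fun _ => .inr h0.le
  · intro x hx
    refine (lp_sum_le_sigmaTail hp hfin hs x y').trans ?_
    gcongr with i
    exact hx i

/-- For a representation of `0`, the partial sums are small when tested against the biduals. -/
theorem IsSigmaRep.norm_sum_bidual_le (hp : 1 ≤ p) {lam : lp (fun _ : ℕ => 𝕜) (conjExp p)}
    (h : IsSigmaRep p (0 : ContinuousMultilinearMap 𝕜 E F) lam x' y)
    (x'' : ∀ i, StrongDual 𝕜 (StrongDual 𝕜 (E i))) (y' : StrongDual 𝕜 F) (N : ℕ) :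
    ‖∑ j ∈ Finset.range N, lam j * ((∏ i, x'' i (x' j i)) * y' (y j))‖ ≤
      ‖lam‖ * ((∏ i, ‖x'' i‖) * ‖y'‖ * (sigmaTail p x' y N).toReal) := by
  have hfin : sigmaTail p x' y N ≠ ∞ :=
    ((sigmaTail_anti hp x' y (Nat.zero_le N)).trans_lt h.sup_lt_top).ne
  refine le_of_goldstine x' x''
    (Φ := fun a => ‖∑ j ∈ Finset.range N, lam j * (a j * y' (y j))‖) (by fun_prop) fun x hx => ?_
  have h1 := (y'.continuous.tendsto _).comp (h.tendsto_sum x)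
  have e : ∀ M, y' (∑ j ∈ Finset.range M, lam j • elemTensor (x' j) (y j) x) =
      ∑ j ∈ Finset.range M, lam j * ((∏ i, x' j i (x i)) * y' (y j)) := by
    intro M
    simp [map_sum]
  simp only [Function.comp_def, e] at h1
  have h2 := (h1.const_sub
    (∑ j ∈ Finset.range N, lam j * ((∏ i, x' j i (x i)) * y' (y j)))).norm
  simp only [zero_apply, map_zero, sub_zero] at h2
  refine le_of_tendsto h2 ((Filter.eventually_ge_atTop N).mono fun M hM => ?_)
  -- At points of the `E i` the whole series sums to `y' 0 = 0`, so the `N`-th partial sum is minus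
  -- the limit of the blocks from `N` to `M`, which Hölder controls by the tail.
  rw [norm_sub_rev, ← Finset.sum_Ico_eq_sub _ hM]
  refine (holder_finset hp lam _ _).trans (mul_le_mul_of_nonneg_left ?_ (lp.norm_nonneg' lam))
  refine (lp_sum_le_sigmaTail hp hfin (fun j hj => (Finset.mem_Ico.1 hj).1) x y').trans ?_
  gcongr with i
  exact hx i

end Estimates

/-! ### The trace functional of a `τ(p)`-summing operator -/

section TauFunctional

variable {𝕜 : Type*} [RCLike 𝕜] {n : ℕ} {E : Fin n → Type*} {F : Type*}
  [∀ i, NormedAddCommGroup (E i)] [∀ i, NormedSpace 𝕜 (E i)]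
  [NormedAddCommGroup F] [NormedSpace 𝕜 F]
  {p : ℝ} {x' : ℕ → ∀ i, StrongDual 𝕜 (E i)} {y : ℕ → F}
  {S : ContinuousMultilinearMap 𝕜 (fun i => StrongDual 𝕜 (E i)) (StrongDual 𝕜 F)} {C : ℝ}

/-- The summing inequality is applied with evaluation at `y j` as the functional on `F'`. The
operators `T i` are kept so that the bound depends on them only through their norms, which allows
uniform finite rank approximation. -/
theorem IsTauBound.lp_sum_le (hp : 1 ≤ p) (hS : IsTauBound p S C)
    (T : ∀ i, StrongDual 𝕜 (E i) →L[𝕜] StrongDual 𝕜 (E i)) {m : ℕ}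
    (hfin : sigmaTail p x' y m ≠ ∞) {s : Finset ℕ} (hs : ∀ j ∈ s, m ≤ j) :
    (∑ j ∈ s, ‖S (fun i => T i (x' j i)) (y j)‖ ^ p) ^ (1 / p) ≤
      C * ((∏ i, ‖T i‖) * (sigmaTail p x' y m).toReal) := by
  have h1 := hS.2 s.card (fun k i => T i (x' (s.equivFin.symm k) i))
    (fun k => NormedSpace.inclusionInDoubleDual 𝕜 F (y (s.equivFin.symm k)))
  have e : ∀ f : ℕ → ℝ, ∑ k : Fin s.card, f (s.equivFin.symm k) = ∑ j ∈ s, f j := fun f => by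
    rw [← Finset.sum_coe_sort s f]
    exact Equiv.sum_comp s.equivFin.symm fun j : s => f j
  simp only [NormedSpace.dual_def] at h1
  rw [e fun j => ‖S (fun i => T i (x' j i)) (y j)‖ ^ p] at h1
  refine h1.trans (mul_le_mul_of_nonneg_left ?_ hS.1)
  refine Real.sSup_le ?_ (by positivity)
  rintro _ ⟨x'', y', hx'', hy', rfl⟩
  simp only [NormedSpace.dual_def]
  rw [e fun j => ‖(∏ i, x'' i (T i (x' j i))) * y' (y j)‖ ^ p]
  -- `T i` is absorbed into the bidual functional: `x'' i ∘ T i` has norm at most `‖T i‖`.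
  refine (lp_sum_bidual_le_sigmaTail hp hfin hs (fun i => (x'' i).comp (T i)) y').trans ?_
  refine mul_le_mul_of_nonneg_right ?_ ENNReal.toReal_nonneg
  refine (mul_le_of_le_one_right (by positivity) hy').trans
    (Finset.prod_le_prod (fun _ _ => by positivity) fun i _ => ?_)
  exact (ContinuousLinearMap.opNorm_comp_le _ _).trans
    (mul_le_of_le_one_left (norm_nonneg _) (hx'' i))

theorem IsTauBound.norm_sum_le (hp : 1 ≤ p) (hS : IsTauBound p S C)
    (lam : lp (fun _ : ℕ => 𝕜) (conjExp p))
    {m : ℕ} (hfin : sigmaTail p x' y m ≠ ∞) {s : Finset ℕ} (hs : ∀ j ∈ s, m ≤ j) :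
    ‖∑ j ∈ s, lam j * S (x' j) (y j)‖ ≤ ‖lam‖ * (C * (sigmaTail p x' y m).toReal) := by
  refine (holder_finset hp lam _ _).trans (mul_le_mul_of_nonneg_left ?_ (lp.norm_nonneg' lam))
  have h1 := hS.lp_sum_le hp (fun i => ContinuousLinearMap.id 𝕜 _) hfin hs
  refine h1.trans (mul_le_mul_of_nonneg_left ?_ hS.1)
  exact mul_le_of_le_one_left ENNReal.toReal_nonneg
    (Finset.prod_le_one (fun _ _ => by positivity) fun i _ => ContinuousLinearMap.norm_id_le)

theorem IsSigmaRep.sigmaTail_ne_top (hp : 1 ≤ p) {A : ContinuousMultilinearMap 𝕜 E F}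
    {lam : lp (fun _ : ℕ => 𝕜) (conjExp p)} (h : IsSigmaRep p A lam x' y) (m : ℕ) :
    sigmaTail p x' y m ≠ ∞ :=
  ((sigmaTail_anti hp x' y (Nat.zero_le m)).trans_lt h.sup_lt_top).ne

theorem IsSigmaRep.tendsto_toReal {A : ContinuousMultilinearMap 𝕜 E F}
    {lam : lp (fun _ : ℕ => 𝕜) (conjExp p)} (h : IsSigmaRep p A lam x' y) :
    Filter.Tendsto (fun m => (sigmaTail p x' y m).toReal) Filter.atTop (𝓝 0) := by
  simpa [Function.comp_def] using
    (ENNReal.tendsto_toReal (by simp : (0 : ℝ≥0∞) ≠ ∞)).comp h.tendsto_tail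

/-! ### Finite rank approximation and vanishing of the trace along representations of zero. -/

theorem exists_finiteRank_expansion {X : Type*} [NormedAddCommGroup X] [NormedSpace 𝕜 X]
    (T : X →L[𝕜] X) (hT : FiniteDimensional 𝕜 T.range) :
    ∃ (d : ℕ) (ψ : Fin d → StrongDual 𝕜 X) (b : Fin d → X), ∀ v, T v = ∑ k, ψ k v • b k := by
  let b := Module.finBasis 𝕜 T.range
  let R : X →L[𝕜] T.range := T.codRestrict T.range fun v => LinearMap.mem_range_self _ v
  refine ⟨_, fun k => (LinearMap.toContinuousLinearMap (b.coord k)).comp R,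
    fun k => (b k : X), fun v => ?_⟩
  have := congrArg (Subtype.val) (b.sum_repr (R v))
  simp only [Submodule.coe_sum, Submodule.coe_smul] at this
  exact this.symm

/-- Expanding each `T i` in a basis of its range and using multilinearity, the trace splits into
finitely many sums in which `S` enters only through the fixed functionals `S (b r)` on `F`. Each
tends to `0` by the bidual estimate, so no summing property of `S` is needed. -/
theorem IsSigmaRep.tendsto_finiteRank (hp : 1 ≤ p) {lam : lp (fun _ : ℕ => 𝕜) (conjExp p)}
    (h : IsSigmaRep p (0 : ContinuousMultilinearMap 𝕜 E F) lam x' y)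
    (S : ContinuousMultilinearMap 𝕜 (fun i => StrongDual 𝕜 (E i)) (StrongDual 𝕜 F))
    (T : ∀ i, StrongDual 𝕜 (E i) →L[𝕜] StrongDual 𝕜 (E i))
    (hT : ∀ i, FiniteDimensional 𝕜 (T i).range) :
    Filter.Tendsto (fun N => ∑ j ∈ Finset.range N, lam j * S (fun i => T i (x' j i)) (y j))
      Filter.atTop (𝓝 0) := by
  classical
  choose d ψ b hb using fun i => exists_finiteRank_expansion (T i) (hT i)
  have e : ∀ j, S (fun i => T i (x' j i)) (y j) =
      ∑ r : ∀ i, Fin (d i), (∏ i, ψ i (r i) (x' j i)) * S (fun i => b i (r i)) (y j) := by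
    intro j
    simp only [hb]
    rw [ContinuousMultilinearMap.map_sum, sum_apply]
    refine Finset.sum_congr rfl fun r _ => ?_
    rw [ContinuousMultilinearMap.map_smul_univ, smul_apply, smul_eq_mul]
  have e2 : ∀ N, ∑ j ∈ Finset.range N, lam j * S (fun i => T i (x' j i)) (y j) =
      ∑ r : ∀ i, Fin (d i), ∑ j ∈ Finset.range N,
        lam j * ((∏ i, ψ i (r i) (x' j i)) * S (fun i => b i (r i)) (y j)) := by
    intro N
    simp only [e, Finset.mul_sum]
    exact Finset.sum_comm
  simp only [e2]
  rw [← Finset.sum_const_zero (s := (Finset.univ : Finset (∀ i, Fin (d i)))) (M := 𝕜)]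
  refine tendsto_finsetSum _ fun r _ => ?_
  refine squeeze_zero_norm
    (h.norm_sum_bidual_le hp (fun i => ψ i (r i)) (S fun i => b i (r i))) ?_
  have := (h.tendsto_toReal.const_mul
    ((∏ i, ‖ψ i (r i)‖) * ‖S fun i => b i (r i)‖)).const_mul ‖lam‖
  simpa using this

theorem HasBoundedApproximationProperty.exists_seq {X : Type*} [NormedAddCommGroup X]
    [NormedSpace 𝕜 X] (hX : HasBoundedApproximationProperty 𝕜 X) (x : ℕ → X) :
    ∃ γ : ℝ, 0 ≤ γ ∧ ∃ T : ℕ → X →L[𝕜] X, (∀ k, FiniteDimensional 𝕜 (T k).range) ∧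
      (∀ k, ‖T k‖ ≤ γ) ∧ ∀ j, Filter.Tendsto (fun k => T k (x j)) Filter.atTop (𝓝 (x j)) := by
  obtain ⟨γ, hγ, h⟩ := hX
  -- The compact sets are the finite initial segments of the sequence, so only pointwise convergence
  -- with a uniform norm bound is extracted.
  choose T hfd hn hT using fun k : ℕ => h (x '' Set.Iio k) ((Set.finite_Iio k).image x).isCompact
    (1 / ((k : ℝ) + 1)) Nat.one_div_pos_of_nat
  refine ⟨γ, by linarith, T, hfd, hn, fun j => ?_⟩
  rw [tendsto_iff_norm_sub_tendsto_zero]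
  refine squeeze_zero' (.of_forall fun _ => norm_nonneg _) ?_
    (tendsto_one_div_add_atTop_nhds_zero_nat (𝕜 := ℝ))
  filter_upwards [Filter.eventually_gt_atTop j] with k hk
  exact hT k _ ⟨j, hk, rfl⟩

/-- The trace of a `τ(p)`-summing operator along a representation of `0` vanishes. -/
theorem IsTauBound.tendsto_zero (hp : 1 ≤ p)
    (hE : ∀ i, HasBoundedApproximationProperty 𝕜 (StrongDual 𝕜 (E i)))
    (hS : IsTauBound p S C) {lam : lp (fun _ : ℕ => 𝕜) (conjExp p)}
    (h : IsSigmaRep p (0 : ContinuousMultilinearMap 𝕜 E F) lam x' y) :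
    Filter.Tendsto (fun N => ∑ j ∈ Finset.range N, lam j * S (x' j) (y j))
      Filter.atTop (𝓝 0) := by
  choose γ hγ T hfd hn hT using fun i => (hE i).exists_seq fun j => x' j i
  have key : ∀ N, ‖∑ j ∈ Finset.range N, lam j * S (x' j) (y j)‖ ≤
      ‖lam‖ * (C * ((∏ i, γ i) * (sigmaTail p x' y N).toReal)) := by
    intro N
    -- With `N` fixed only finitely many `x' j` occur, so the partial sum is the limit of its finite
    -- rank versions and it suffices to bound these uniformly in `k`.
    have happrox : Filter.Tendsto
        (fun k => ‖∑ j ∈ Finset.range N, lam j * S (fun i => T i k (x' j i)) (y j)‖)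
        Filter.atTop (𝓝 ‖∑ j ∈ Finset.range N, lam j * S (x' j) (y j)‖) := by
      refine (tendsto_finsetSum _ fun j _ => Filter.Tendsto.const_mul _ ?_).norm
      have h1 : Filter.Tendsto (fun k i => T i k (x' j i)) Filter.atTop (𝓝 (x' j)) :=
        tendsto_pi_nhds.2 fun i => hT i j
      exact (((ContinuousLinearMap.apply 𝕜 𝕜 (y j)).continuous.comp S.cont).tendsto _).comp h1
    refine le_of_tendsto' happrox fun k => ?_
    -- For fixed `k` the complete finite rank trace is `0`, so its `N`-th partial sum is, up to
    -- sign, its tail.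
    have hlim := ((h.tendsto_finiteRank hp S (fun i => T i k) fun i => hfd i k).const_sub
      (∑ j ∈ Finset.range N, lam j * S (fun i => T i k (x' j i)) (y j))).norm
    rw [sub_zero] at hlim
    refine le_of_tendsto hlim ((Filter.eventually_ge_atTop N).mono fun M hM => ?_)
    rw [norm_sub_rev, ← Finset.sum_Ico_eq_sub _ hM]
    refine (holder_finset hp lam _ _).trans (mul_le_mul_of_nonneg_left ?_ (lp.norm_nonneg' lam))
    refine (hS.lp_sum_le hp (fun i => T i k) (h.sigmaTail_ne_top hp N)
      fun j hj => (Finset.mem_Ico.1 hj).1).trans ?_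
    refine mul_le_mul_of_nonneg_left (mul_le_mul_of_nonneg_right ?_ ENNReal.toReal_nonneg) hS.1
    exact Finset.prod_le_prod (fun _ _ => by positivity) fun i _ => hn i k
  refine squeeze_zero_norm key ?_
  have := ((h.tendsto_toReal.const_mul (∏ i, γ i)).const_mul C).const_mul ‖lam‖
  simpa using this

/-! ### Existence, independence of the representation, and norm of the trace. -/

/-- Hölder and the summing inequality bound the block from `N` to `M` by a multiple of the `N`-th
tail, so the partial sums are Cauchy; no approximation property enters. -/
theorem IsTauBound.exists_tendsto (hp : 1 ≤ p) (hS : IsTauBound p S C)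
    {A : ContinuousMultilinearMap 𝕜 E F} {lam : lp (fun _ : ℕ => 𝕜) (conjExp p)}
    (h : IsSigmaRep p A lam x' y) :
    ∃ v : 𝕜, Filter.Tendsto (fun N => ∑ j ∈ Finset.range N, lam j * S (x' j) (y j))
      Filter.atTop (𝓝 v) := by
  refine cauchySeq_tendsto_of_complete (cauchySeq_of_le_tendsto_0'
    (fun N => ‖lam‖ * (C * (sigmaTail p x' y N).toReal)) (fun N M hNM => ?_) ?_)
  · rw [dist_comm, dist_eq_norm, ← Finset.sum_Ico_eq_sub _ hNM]
    exact hS.norm_sum_le hp lam (h.sigmaTail_ne_top hp N) fun j hj => (Finset.mem_Ico.1 hj).1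
  · simpa using (h.tendsto_toReal.const_mul C).const_mul ‖lam‖

/-- `v` is the trace of `S` along every representation of `A`. -/
def IsTrace (p : ℝ)
    (S : ContinuousMultilinearMap 𝕜 (fun i => StrongDual 𝕜 (E i)) (StrongDual 𝕜 F))
    (A : ContinuousMultilinearMap 𝕜 E F) (v : 𝕜) : Prop :=
  ∀ lam x' y, IsSigmaRep p A lam x' y →
    Filter.Tendsto (fun N => ∑ j ∈ Finset.range N, lam j * S (x' j) (y j)) Filter.atTop (𝓝 v)

theorem tendsto_interleave_trace {lam mu : ℕ → 𝕜} {x₁ x₂ : ℕ → ∀ i, StrongDual 𝕜 (E i)}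
    {y₁ y₂ : ℕ → F} {v w : 𝕜}
    (hv : Filter.Tendsto (fun N => ∑ j ∈ Finset.range N, lam j * S (x₁ j) (y₁ j))
      Filter.atTop (𝓝 v))
    (hw : Filter.Tendsto (fun N => ∑ j ∈ Finset.range N, mu j * S (x₂ j) (y₂ j))
      Filter.atTop (𝓝 w)) :
    Filter.Tendsto (fun N => ∑ j ∈ Finset.range N, interleave lam mu j *
      S (interleave x₁ x₂ j) (interleave y₁ y₂ j)) Filter.atTop (𝓝 (v + w)) := by
  have e : ∀ N, ∑ j ∈ Finset.range N, interleave lam mu j *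
      S (interleave x₁ x₂ j) (interleave y₁ y₂ j) =
      ∑ j ∈ Finset.range ((N + 1) / 2), lam j * S (x₁ j) (y₁ j) +
      ∑ j ∈ Finset.range (N / 2), mu j * S (x₂ j) (y₂ j) := by
    intro N
    rw [← sum_interleave (fun j => lam j * S (x₁ j) (y₁ j))]
    refine Finset.sum_congr rfl fun j _ => ?_
    unfold interleave
    split_ifs <;> rfl
  have h1 : Filter.Tendsto (fun N : ℕ => (N + 1) / 2) Filter.atTop Filter.atTop :=
    Filter.tendsto_atTop.2 fun b => (Filter.eventually_ge_atTop (2 * b)).mono fun N hN => by omega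
  have h2 : Filter.Tendsto (fun N : ℕ => N / 2) Filter.atTop Filter.atTop :=
    Filter.tendsto_atTop.2 fun b => (Filter.eventually_ge_atTop (2 * b)).mono fun N hN => by omega
  simp only [e]
  exact (hv.comp h1).add (hw.comp h2)

theorem IsTauBound.exists_isTrace (hp : 1 ≤ p)
    (hE : ∀ i, HasBoundedApproximationProperty 𝕜 (StrongDual 𝕜 (E i)))
    (hS : IsTauBound p S C) {A : ContinuousMultilinearMap 𝕜 E F} (hA : IsSigmaNuclear p A) :
    ∃ v : 𝕜, IsTrace p S A v := by
  obtain ⟨mu, z', w, h⟩ := hA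
  obtain ⟨v, hv⟩ := hS.exists_tendsto hp h
  refine ⟨v, fun lam x' y h' => ?_⟩
  obtain ⟨v', hv'⟩ := hS.exists_tendsto hp h'
  -- Interleaving the negated first representation with the second represents `0`. Its trace is `-v
  -- + v'` on one hand and `0` by `IsTauBound.tendsto_zero` on the other.
  have hsub := (h.smul (-1)).add hp h'
  have hA0 : (-1 : 𝕜) • A + A = 0 := by simp
  rw [hA0] at hsub
  have h0 := hS.tendsto_zero hp hE hsub
  have hneg : Filter.Tendsto (fun N => ∑ j ∈ Finset.range N,
      ((-1 : 𝕜) • mu : lp (fun _ : ℕ => 𝕜) (conjExp p)) j * S (z' j) (w j))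
      Filter.atTop (𝓝 (-v)) := by
    simpa using hv.neg
  have := tendsto_nhds_unique h0 (tendsto_interleave_trace hneg hv')
  have hvv : v = v' := by linear_combination this
  rwa [hvv]

theorem IsTrace.norm_le (hp : 1 ≤ p) (hS : IsTauBound p S C)
    {A : ContinuousMultilinearMap 𝕜 E F} (hA : IsSigmaNuclear p A) {v : 𝕜}
    (hv : IsTrace p S A v) : ‖v‖ ≤ C * sigmaNorm p A := by
  have key : ∀ b, sigmaNorm p A < b → ‖v‖ ≤ C * b := by
    intro b hb
    obtain ⟨lam, x', y, h, hlt⟩ := exists_rep_lt hA hb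
    refine le_of_tendsto' (hv _ _ _ h).norm fun N => ?_
    refine (hS.norm_sum_le hp lam (h.sigmaTail_ne_top hp 0) fun j _ => Nat.zero_le j).trans ?_
    rw [mul_left_comm]
    exact mul_le_mul_of_nonneg_left hlt.le hS.1
  have h1 : Filter.Tendsto (fun b => C * b) (𝓝[>] sigmaNorm p A) (𝓝 (C * sigmaNorm p A)) :=
    (continuous_const.mul continuous_id).continuousAt.tendsto.mono_left nhdsWithin_le_nhds
  exact ge_of_tendsto h1 (Filter.mem_of_superset self_mem_nhdsWithin key)

end TauFunctional

/-! ### The Borel transform -/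

section Borel

variable {𝕜 : Type*} [RCLike 𝕜] {n : ℕ} {E : Fin n → Type*} {F : Type*}
  [∀ i, NormedAddCommGroup (E i)] [∀ i, NormedSpace 𝕜 (E i)]
  [NormedAddCommGroup F] [NormedSpace 𝕜 F]

/-- The `ℓᵖ`-norm of a finite sequence is attained against the unit ball of `ℓ_{p'}`. -/
theorem exists_lp_dual {p : ℝ} (hp : 1 ≤ p) (a : ℕ → 𝕜) (m : ℕ) :
    ∃ lam : lp (fun _ : ℕ => 𝕜) (conjExp p), ‖lam‖ ≤ 1 ∧
      ∑ j ∈ Finset.range m, lam j * a j =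
        (((∑ j ∈ Finset.range m, ‖a j‖ ^ p) ^ (1 / p) : ℝ) : 𝕜) := by
  choose c hc hca using fun j => RCLike.exists_norm_eq_mul_self (a j)
  rcases hp.eq_or_lt with rfl | hp1
  -- The exponent is generalized so that `∞` can be substituted for `conjExp 1` inside the dependent
  -- type `lp`; for `p = 1` the phases alone are the extremal sequence.
  · suffices H : ∀ q : ℝ≥0∞, q = ∞ → ∃ lam : lp (fun _ : ℕ => 𝕜) q, ‖lam‖ ≤ 1 ∧
        ∑ j ∈ Finset.range m, lam j * a j =
          (((∑ j ∈ Finset.range m, ‖a j‖ ^ (1 : ℝ)) ^ (1 / (1 : ℝ)) : ℝ) : 𝕜) from H _ conjExp_one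
    rintro _ rfl
    refine ⟨⟨c, memℓp_infty ⟨1, ?_⟩⟩, lp.norm_le_of_forall_le zero_le_one fun j => (hc j).le, ?_⟩
    · rintro _ ⟨j, rfl⟩
      exact (hc j).le
    · simp [← hca]
  · obtain ⟨hq, hH⟩ := conjExp_holder hp1
    have hq' := ENNReal.toReal_pos (conjExp_ne_zero hp) hq
    obtain ⟨⟨g, hg, hga⟩, -⟩ := NNReal.isGreatest_Lp (Finset.range m) (fun j => ‖a j‖₊) hH
    -- The nonnegative Hölder maximizer for the moduli, multiplied by the phases of `a` and cut off
    -- at `m`.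
    set f : ℕ → 𝕜 := fun j => if j < m then ((g j : ℝ) : 𝕜) * c j else 0 with hf
    have hnorm : ∀ j, ‖f j‖ = if j < m then (g j : ℝ) else 0 := by
      intro j
      simp only [hf]
      split_ifs
      · rw [norm_mul, hc, mul_one, RCLike.norm_ofReal, abs_of_nonneg (NNReal.coe_nonneg _)]
      · simp
    have hsum : ∀ s : Finset ℕ, ∑ j ∈ s, ‖f j‖ ^ (conjExp p).toReal ≤ 1 := by
      intro s
      have hg' : ∑ j ∈ Finset.range m, (g j : ℝ) ^ (conjExp p).toReal ≤ 1 := by exact_mod_cast hg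
      refine le_trans ?_ hg'
      have h1 : ∑ j ∈ s, ‖f j‖ ^ (conjExp p).toReal ≤
          ∑ j ∈ s ∪ Finset.range m, ‖f j‖ ^ (conjExp p).toReal :=
        Finset.sum_le_sum_of_subset_of_nonneg Finset.subset_union_left fun _ _ _ => by positivity
      refine h1.trans (le_of_eq ?_)
      rw [← Finset.sum_subset Finset.subset_union_right]
      · refine Finset.sum_congr rfl fun j hj => ?_
        rw [hnorm, if_pos (Finset.mem_range.1 hj)]
      · intro j _ hj
        rw [hnorm, if_neg (by simpa using hj), Real.zero_rpow hq'.ne']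
    refine ⟨⟨f, memℓp_gen' hsum⟩, lp.norm_le_of_forall_sum_le hq' zero_le_one fun s => ?_, ?_⟩
    · rw [Real.one_rpow]
      exact hsum s
    · have h2 : ∑ j ∈ Finset.range m, f j * a j =
          ((∑ j ∈ Finset.range m, ‖a j‖ * (g j : ℝ) : ℝ) : 𝕜) := by
        push_cast
        refine Finset.sum_congr rfl fun j hj => ?_
        have h3 : f j = ((g j : ℝ) : 𝕜) * c j := if_pos (Finset.mem_range.1 hj)
        rw [h3, mul_assoc, ← hca, mul_comm]
      rw [h2]
      congr 1
      simpa using congrArg NNReal.toReal hga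

/-! ### Finite representations, remainders and elementary tensors. -/

variable {p : ℝ} {x' : ℕ → ∀ i, StrongDual 𝕜 (E i)} {y : ℕ → F}

/-- Truncating `y` alone suffices: `lam` and `x'` may be arbitrary beyond `m`, since every term
there vanishes and with it every tail from `m` on. -/
theorem isSigmaRep_finite (hp : 1 ≤ p) (lam : lp (fun _ : ℕ => 𝕜) (conjExp p)) {m : ℕ}
    (hy : ∀ j, m ≤ j → y j = 0) {c : ℝ} (hc : 0 ≤ c)
    (h : ∀ x : ∀ i, E i, (∀ i, ‖x i‖ ≤ 1) → ∀ y' : StrongDual 𝕜 F, ‖y'‖ ≤ 1 →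
      (∑ j ∈ Finset.range m, ‖(∏ i, x' j i (x i)) * y' (y j)‖ ^ p) ^ (1 / p) ≤ c) :
    IsSigmaRep p (∑ j ∈ Finset.range m, lam j • elemTensor (x' j) (y j)) lam x' y ∧
      sigmaTail p x' y 0 ≤ ENNReal.ofReal c := by
  have h0 : (0 : ℝ) < p := by linarith
  have hle : sigmaTail p x' y 0 ≤ ENNReal.ofReal c := by
    rw [sigmaTail_le_iff hp]
    intro x hx y' hy'
    rw [tsum_subtype (Set.Ici 0) (fun j => ‖(∏ i, x' j i (x i)) * y' (y j)‖ₑ ^ p),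
      tsum_eq_sum (s := Finset.range m) fun j hj => by
        simp [Set.indicator, hy j (by simpa using hj), h0]]
    have h1 := h x hx y' hy'
    rw [one_div, Real.rpow_inv_le_iff_of_pos (by positivity) hc h0] at h1
    rw [ENNReal.ofReal_rpow_of_nonneg hc h0.le]
    refine le_trans (le_of_eq ?_) (ENNReal.ofReal_le_ofReal h1)
    rw [ENNReal.ofReal_sum_of_nonneg fun _ _ => by positivity]
    refine Finset.sum_congr rfl fun j _ => ?_
    rw [← ENNReal.ofReal_rpow_of_nonneg (norm_nonneg _) h0.le, ofReal_norm]
    simp [Set.indicator]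
  refine ⟨⟨fun x => ?_, hle.trans_lt ENNReal.ofReal_lt_top, ?_⟩, hle⟩
  · refine tendsto_const_nhds.congr' ((Filter.eventually_ge_atTop m).mono fun N hN => ?_)
    rw [sum_apply]
    refine Finset.sum_subset (Finset.range_subset_range.2 hN) fun j _ hj => ?_
    simp [hy j (by simpa using hj)]
  · refine tendsto_const_nhds.congr' ((Filter.eventually_ge_atTop m).mono fun k hk => ?_)
    symm
    rw [← nonpos_iff_eq_zero, sigmaTail_le_iff hp]
    intro x hx y' hy'
    rw [ENNReal.zero_rpow_of_pos h0, nonpos_iff_eq_zero, ENNReal.tsum_eq_zero]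
    rintro ⟨j, hj⟩
    simp [hy j (hk.trans hj), h0]

/-- The remainder of a representation represents the difference with a partial sum. -/
theorem IsSigmaRep.remainder (hp : 1 ≤ p) {A : ContinuousMultilinearMap 𝕜 E F}
    {lam : lp (fun _ : ℕ => 𝕜) (conjExp p)} (h : IsSigmaRep p A lam x' y) (m : ℕ) :
    IsSigmaRep p (A - ∑ j ∈ Finset.range m, lam j • elemTensor (x' j) (y j)) lam x'
      (fun j => if j < m then 0 else y j) ∧
      sigmaTail p x' (fun j => if j < m then 0 else y j) 0 ≤ sigmaTail p x' y m := by
  have h0 : (0 : ℝ) < p := by linarith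
  -- Zeroing the first `m` vectors leaves, from `k` on, just the terms with index at least `max k
  -- m`.
  have hle : ∀ k, sigmaTail p x' (fun j => if j < m then 0 else y j) k ≤
      sigmaTail p x' y (max k m) := by
    intro k
    rw [sigmaTail_le_iff hp]
    intro x hx y' hy'
    refine le_trans ?_ (le_sigmaTail hp x' y (max k m) hx hy')
    rw [tsum_subtype (Set.Ici k)
        (fun j => ‖(∏ i, x' j i (x i)) * y' (if j < m then 0 else y j)‖ₑ ^ p),
      tsum_subtype (Set.Ici (max k m)) (fun j => ‖(∏ i, x' j i (x i)) * y' (y j)‖ₑ ^ p)]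
    refine ENNReal.tsum_le_tsum fun j => ?_
    by_cases h1 : j < m
    · simp [Set.indicator, h1, h0]
    · by_cases h2 : k ≤ j
      · simp [Set.indicator, h1, h2, not_lt.1 h1]
      · simp [Set.indicator, h2]
  have hle' := fun k => (hle k).trans (sigmaTail_anti hp x' y (le_max_left k m))
  refine ⟨⟨fun x => ?_, (hle' 0).trans_lt h.sup_lt_top, ?_⟩, by simpa using hle 0⟩
  · refine ((h.tendsto_sum x).sub_const
      (∑ j ∈ Finset.range m, lam j • elemTensor (x' j) (y j) x)).congr' ?_ |>.trans
      (le_of_eq (by simp [sum_apply]))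
    filter_upwards [Filter.eventually_ge_atTop m] with N hN
    have hz : ∑ j ∈ Finset.range m,
        lam j • elemTensor (x' j) (if j < m then 0 else y j) x = 0 :=
      Finset.sum_eq_zero fun j hj => by simp [Finset.mem_range.1 hj]
    rw [← Finset.sum_Ico_eq_sub _ hN, ← Finset.sum_range_add_sum_Ico _ hN, hz, zero_add]
    refine Finset.sum_congr rfl fun j hj => ?_
    rw [if_neg (by have := (Finset.mem_Ico.1 hj).1; omega)]
  · exact tendsto_of_tendsto_of_tendsto_of_le_of_le tendsto_const_nhds h.tendsto_tail
      (fun _ => zero_le) hle'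

variable [hp : Fact (1 ≤ p)]

namespace SigmaNuclear

theorem toCMM_tensor (x' : ∀ i, StrongDual 𝕜 (E i)) (y : F) :
    toCMM (tensor p x' y) = elemTensor x' y := rfl

theorem toCMM_sum_tensor (lam : ℕ → 𝕜) (x' : ℕ → ∀ i, StrongDual 𝕜 (E i)) (y : ℕ → F) (m : ℕ) :
    toCMM (∑ j ∈ Finset.range m, lam j • tensor p (x' j) (y j)) =
      ∑ j ∈ Finset.range m, lam j • elemTensor (x' j) (y j) := by
  simp [map_sum, toCMM_tensor]

theorem norm_sum_tensor_le (lam : lp (fun _ : ℕ => 𝕜) (conjExp p)) {m : ℕ}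
    (hy : ∀ j, m ≤ j → y j = 0) {c : ℝ} (hc : 0 ≤ c)
    (h : ∀ x : ∀ i, E i, (∀ i, ‖x i‖ ≤ 1) → ∀ y' : StrongDual 𝕜 F, ‖y'‖ ≤ 1 →
      (∑ j ∈ Finset.range m, ‖(∏ i, x' j i (x i)) * y' (y j)‖ ^ p) ^ (1 / p) ≤ c) :
    ‖∑ j ∈ Finset.range m, lam j • tensor p (x' j) (y j)‖ ≤ ‖lam‖ * c := by
  obtain ⟨h1, h2⟩ := isSigmaRep_finite hp.out lam hy hc h
  rw [norm_def, toCMM_sum_tensor]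
  exact (sigmaNorm_le h1).trans (mul_le_mul_of_nonneg_left
    (ENNReal.toReal_le_of_le_ofReal hc h2) (lp.norm_nonneg' lam))

theorem single_apply_zero (q : ℝ≥0∞) :
    (lp.single q 0 (1 : 𝕜) : lp (fun _ : ℕ => 𝕜) q) 0 = 1 := by
  rw [lp.coeFn_single, Pi.single_apply, if_pos rfl]

theorem lp_tensor_le (x' : ∀ i, StrongDual 𝕜 (E i)) (y : F)
    (x : ∀ i, E i) (hx : ∀ i, ‖x i‖ ≤ 1) (y' : StrongDual 𝕜 F) (hy' : ‖y'‖ ≤ 1) :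
    (∑ j ∈ Finset.range 1, ‖(∏ i, x' i (x i)) * y' (if j = 0 then y else 0)‖ ^ p) ^ (1 / p) ≤
      (∏ i, ‖x' i‖) * ‖y‖ := by
  have h0 : (0 : ℝ) < p := by linarith [hp.out]
  rw [Finset.sum_range_one, if_pos rfl, one_div, Real.rpow_rpow_inv (norm_nonneg _) h0.ne',
    norm_mul, norm_prod]
  refine mul_le_mul (Finset.prod_le_prod (fun _ _ => norm_nonneg _) fun i _ => ?_) ?_
    (norm_nonneg _) (by positivity)
  · exact (x' i).unit_le_opNorm _ (hx i)
  · exact (y'.le_opNorm y).trans (mul_le_of_le_one_left (norm_nonneg _) hy')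

theorem isSigmaRep_tensor (x' : ∀ i, StrongDual 𝕜 (E i)) (y : F) :
    IsSigmaRep p (elemTensor x' y) (lp.single _ 0 1) (fun _ => x')
      (fun j => if j = 0 then y else 0) := by
  have := (isSigmaRep_finite hp.out (lp.single _ 0 1) (x' := fun _ => x')
    (y := fun j => if j = 0 then y else 0) (m := 1)
    (fun j hj => if_neg (by omega)) (by positivity) (lp_tensor_le x' y)).1
  simpa [single_apply_zero] using this

theorem norm_tensor_le (x' : ∀ i, StrongDual 𝕜 (E i)) (y : F) :
    ‖tensor p x' y‖ ≤ (∏ i, ‖x' i‖) * ‖y‖ := by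
  have := norm_sum_tensor_le (p := p) (lp.single _ 0 1) (x' := fun _ => x')
    (y := fun j => if j = 0 then y else 0) (m := 1)
    (fun j hj => if_neg (by omega)) (by positivity) (lp_tensor_le x' y)
  rw [Finset.sum_range_one, single_apply_zero, one_smul, if_pos rfl,
    lp.norm_single (pos_iff_ne_zero.2 (conjExp_ne_zero hp.out)), norm_one, one_mul] at this
  exact this

theorem tensor_add (x' : ∀ i, StrongDual 𝕜 (E i)) (y z : F) :
    tensor p x' (y + z) = tensor p x' y + tensor p x' z := by
  apply toCMM_injective
  ext x
  simp [toCMM_tensor]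

theorem tensor_smul (x' : ∀ i, StrongDual 𝕜 (E i)) (c : 𝕜) (y : F) :
    tensor p x' (c • y) = c • tensor p x' y := by
  apply toCMM_injective
  ext x
  simp only [toCMM_tensor, map_smul, smul_apply, elemTensor_apply]
  rw [smul_comm]

theorem prod_update_apply [DecidableEq (Fin n)] (x' : ∀ i, StrongDual 𝕜 (E i)) (i : Fin n)
    (v : StrongDual 𝕜 (E i)) (x : ∀ i, E i) :
    ∏ k, Function.update x' i v k (x k) = v (x i) * ∏ k ∈ Finset.univ \ {i}, x' k (x k) := by
  have e : ∀ k, Function.update x' i v k (x k) =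
      Function.update (fun k => x' k (x k)) i (v (x i)) k := fun k => by
    rw [Function.apply_update (fun k (f : StrongDual 𝕜 (E k)) => f (x k))]
  simp only [e]
  exact Finset.prod_update_of_mem (Finset.mem_univ i) _ _

theorem tensor_update_add [DecidableEq (Fin n)] (x' : ∀ i, StrongDual 𝕜 (E i)) (i : Fin n)
    (u v : StrongDual 𝕜 (E i)) (y : F) :
    tensor p (Function.update x' i (u + v)) y =
      tensor p (Function.update x' i u) y + tensor p (Function.update x' i v) y := by
  apply toCMM_injective
  ext x
  simp [toCMM_tensor, prod_update_apply, add_mul, add_smul]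

theorem tensor_update_smul [DecidableEq (Fin n)] (x' : ∀ i, StrongDual 𝕜 (E i)) (i : Fin n)
    (c : 𝕜) (v : StrongDual 𝕜 (E i)) (y : F) :
    tensor p (Function.update x' i (c • v)) y = c • tensor p (Function.update x' i v) y := by
  apply toCMM_injective
  ext x
  simp [toCMM_tensor, prod_update_apply, mul_assoc, mul_smul]

theorem norm_sub_sum_le {A : SigmaNuclear 𝕜 E F p} {lam : lp (fun _ : ℕ => 𝕜) (conjExp p)}
    (h : IsSigmaRep p (toCMM A) lam x' y) (m : ℕ) :
    ‖A - ∑ j ∈ Finset.range m, lam j • tensor p (x' j) (y j)‖ ≤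
      ‖lam‖ * (sigmaTail p x' y m).toReal := by
  obtain ⟨h1, h2⟩ := h.remainder hp.out m
  rw [norm_def, map_sub, toCMM_sum_tensor]
  exact (sigmaNorm_le h1).trans (mul_le_mul_of_nonneg_left
    (ENNReal.toReal_mono (h.sigmaTail_ne_top hp.out m) h2) (lp.norm_nonneg' lam))

/-- The condition `w_m → 0` gives convergence in the nuclear norm, not merely pointwise, because the
remainder is itself represented by the tail. Hence a continuous functional is determined by its
values on elementary tensors. -/
theorem tendsto_sum_tensor {A : SigmaNuclear 𝕜 E F p} {lam : lp (fun _ : ℕ => 𝕜) (conjExp p)}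
    (h : IsSigmaRep p (toCMM A) lam x' y) :
    Filter.Tendsto (fun N => ∑ j ∈ Finset.range N, lam j • tensor p (x' j) (y j)) Filter.atTop
      (𝓝 A) := by
  rw [tendsto_iff_norm_sub_tendsto_zero]
  refine squeeze_zero (fun _ => norm_nonneg _)
    (fun N => (norm_sub_rev _ _).trans_le (norm_sub_sum_le h N)) ?_
  simpa using h.tendsto_toReal.const_mul ‖lam‖

end SigmaNuclear

/-! ### The Borel transform, its isometry and its surjectivity. -/

open SigmaNuclear

/-- The functional `y ↦ φ (x'₁ ⊗ ⋯ ⊗ x'ₙ ⊗ y)`. -/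
def borelFunctional (φ : StrongDual 𝕜 (SigmaNuclear 𝕜 E F p)) (x' : ∀ i, StrongDual 𝕜 (E i)) :
    StrongDual 𝕜 F :=
  LinearMap.mkContinuous
    { toFun := fun y => φ (tensor p x' y)
      map_add' := fun y z => by rw [tensor_add, map_add]
      map_smul' := fun c y => by rw [tensor_smul, map_smul]; rfl }
    (‖φ‖ * ∏ i, ‖x' i‖) fun y => by
      rw [mul_assoc]
      exact (φ.le_opNorm _).trans (mul_le_mul_of_nonneg_left (norm_tensor_le x' y) (norm_nonneg φ))

theorem borelFunctional_apply (φ : StrongDual 𝕜 (SigmaNuclear 𝕜 E F p))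
    (x' : ∀ i, StrongDual 𝕜 (E i)) (y : F) : borelFunctional φ x' y = φ (tensor p x' y) := rfl

theorem norm_borelFunctional_le (φ : StrongDual 𝕜 (SigmaNuclear 𝕜 E F p))
    (x' : ∀ i, StrongDual 𝕜 (E i)) : ‖borelFunctional φ x'‖ ≤ ‖φ‖ * ∏ i, ‖x' i‖ :=
  LinearMap.mkContinuous_norm_le _ (by positivity) _

/-- The Borel transform of a functional, as a continuous multilinear operator. -/
def borelForm (φ : StrongDual 𝕜 (SigmaNuclear 𝕜 E F p)) :
    ContinuousMultilinearMap 𝕜 (fun i => StrongDual 𝕜 (E i)) (StrongDual 𝕜 F) :=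
  MultilinearMap.mkContinuous
    { toFun := borelFunctional φ
      map_update_add' := fun x' i u v => by
        ext y
        simp [borelFunctional_apply, tensor_update_add]
      map_update_smul' := fun x' i c v => by
        ext y
        simp [borelFunctional_apply, tensor_update_smul] }
    ‖φ‖ (norm_borelFunctional_le φ)

theorem borelForm_apply (φ : StrongDual 𝕜 (SigmaNuclear 𝕜 E F p)) (x' : ∀ i, StrongDual 𝕜 (E i))
    (y : F) : borelForm φ x' y = φ (tensor p x' y) := rfl

/-- By `ℓ_p` duality the left side is `φ` at one finite nuclear operator with coefficients in the
unit ball of `ℓ_{p'}`. Its norm is a supremum over the balls of the `E i`, which embed in the bidual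
balls defining `tauSup`. -/
theorem isTauBound_borelForm (hF : IsReflexiveSpace 𝕜 F)
    (φ : StrongDual 𝕜 (SigmaNuclear 𝕜 E F p)) : IsTauBound p (borelForm φ) ‖φ‖ := by
  refine ⟨norm_nonneg φ, fun m z b' => ?_⟩
  -- Reflexivity: the functionals on `F'` become vectors of `F`, so that they can enter elementary
  -- tensors.
  choose w hw using fun j => hF (b' j)
  obtain rfl : (fun j => NormedSpace.inclusionInDoubleDual 𝕜 F (w j)) = b' := funext hw
  -- The finite families are padded by zero, since representations are indexed by `ℕ`.
  set x' : ℕ → ∀ i, StrongDual 𝕜 (E i) := fun j => if h : j < m then z ⟨j, h⟩ else 0 with hx'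
  set y : ℕ → F := fun j => if h : j < m then w ⟨j, h⟩ else 0 with hy
  have ex : ∀ j : Fin m, z j = x' j := fun j => by simp [hx']
  have ey : ∀ j : Fin m, w j = y j := fun j => by simp [hy]
  have hT := tauSup_bddAbove hp.out z (fun j => NormedSpace.inclusionInDoubleDual 𝕜 F (w j))
  set t := tauSup p z (fun j => NormedSpace.inclusionInDoubleDual 𝕜 F (w j)) with ht
  have ht0 : 0 ≤ t := tauSup_nonneg p _ _
  have hbd : ∀ x : ∀ i, E i, (∀ i, ‖x i‖ ≤ 1) → ∀ y' : StrongDual 𝕜 F, ‖y'‖ ≤ 1 →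
      (∑ j ∈ Finset.range m, ‖(∏ i, x' j i (x i)) * y' (y j)‖ ^ p) ^ (1 / p) ≤ t := by
    intro x hx v hv
    refine le_csSup hT ⟨fun i => NormedSpace.inclusionInDoubleDual 𝕜 (E i) (x i), v,
      fun i => (NormedSpace.double_dual_bound 𝕜 (E i) (x i)).trans (hx i), hv, ?_⟩
    simp only [NormedSpace.dual_def, ex, ey]
    rw [Fin.sum_univ_eq_sum_range fun j => ‖(∏ i, x' j i (x i)) * v (y j)‖ ^ p]
  simp only [NormedSpace.dual_def, borelForm_apply, ex, ey]
  rw [Fin.sum_univ_eq_sum_range fun j => ‖φ (tensor p (x' j) (y j))‖ ^ p]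
  obtain ⟨lam, hlam, hsum⟩ := exists_lp_dual hp.out (fun j => φ (tensor p (x' j) (y j))) m
  have e : φ (∑ j ∈ Finset.range m, lam j • tensor p (x' j) (y j)) =
      ∑ j ∈ Finset.range m, lam j * φ (tensor p (x' j) (y j)) := by
    simp [map_sum]
  rw [← e] at hsum
  have hn := congrArg norm hsum
  rw [RCLike.norm_ofReal, abs_of_nonneg (by positivity)] at hn
  rw [← hn]
  refine (φ.le_opNorm _).trans (mul_le_mul_of_nonneg_left ?_ (norm_nonneg φ))
  refine (norm_sum_tensor_le lam (fun j hj => dif_neg (by omega)) ht0 hbd).trans ?_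
  exact mul_le_of_le_one_left ht0 hlam

/-- Norm convergence of representations shows that `φ A` is the trace of `borelForm φ` along each of
them, so the general trace estimate applies; here independence of the representation is automatic.
-/
theorem norm_le_of_isTauBound_borelForm {φ : StrongDual 𝕜 (SigmaNuclear 𝕜 E F p)} {C : ℝ}
    (h : IsTauBound p (borelForm φ) C) : ‖φ‖ ≤ C := by
  refine φ.opNorm_le_bound h.1 fun A => ?_
  refine IsTrace.norm_le hp.out h A.isSigmaNuclear fun lam x' y hr => ?_
  have := (φ.continuous.tendsto A).comp (tendsto_sum_tensor hr)
  simpa [Function.comp_def, map_sum, borelForm_apply] using this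

/-- The Borel transform as a linear map. -/
def borelLinear (hF : IsReflexiveSpace 𝕜 F) : StrongDual 𝕜 (SigmaNuclear 𝕜 E F p) →ₗ[𝕜]
    TauSumming 𝕜 (fun i => StrongDual 𝕜 (E i)) (StrongDual 𝕜 F) p where
  toFun φ := ⟨borelForm φ, ‖φ‖, isTauBound_borelForm hF φ⟩
  map_add' φ ψ := by
    apply TauSumming.toCMM_injective
    ext x' y
    rfl
  map_smul' c φ := by
    apply TauSumming.toCMM_injective
    ext x' y
    rfl

theorem toCMM_borelLinear (hF : IsReflexiveSpace 𝕜 F) (φ : StrongDual 𝕜 (SigmaNuclear 𝕜 E F p)) :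
    TauSumming.toCMM (borelLinear hF φ) = borelForm φ := rfl

theorem norm_borelLinear (hF : IsReflexiveSpace 𝕜 F)
    (φ : StrongDual 𝕜 (SigmaNuclear 𝕜 E F p)) : ‖borelLinear hF φ‖ = ‖φ‖ := by
  refine le_antisymm (tauNorm_le (isTauBound_borelForm hF φ)) ?_
  exact norm_le_of_isTauBound_borelForm (borelLinear hF φ).isTauSumming.isTauBound

/-- The preimage of `S` is its trace functional. Linearity is read off from scaled and interleaved
representations by uniqueness of limits, continuity is the trace estimate, and a one-term
representation recovers `S`. -/
theorem borelLinear_surjective (hF : IsReflexiveSpace 𝕜 F)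
    (hE : ∀ i, HasBoundedApproximationProperty 𝕜 (StrongDual 𝕜 (E i))) :
    Function.Surjective (borelLinear (E := E) (p := p) hF) := by
  intro S
  have hS := S.isTauSumming.isTauBound
  choose v hv using fun A : SigmaNuclear 𝕜 E F p =>
    hS.exists_isTrace hp.out hE A.isSigmaNuclear
  have hadd : ∀ A B, v (A + B) = v A + v B := by
    intro A B
    obtain ⟨l, x₁, y₁, h₁⟩ := A.isSigmaNuclear
    obtain ⟨m, x₂, y₂, h₂⟩ := B.isSigmaNuclear
    have h := h₁.add hp.out h₂
    rw [← map_add] at h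
    exact tendsto_nhds_unique (hv (A + B) _ _ _ h)
      (tendsto_interleave_trace (hv A _ _ _ h₁) (hv B _ _ _ h₂))
  have hsmul : ∀ (c : 𝕜) A, v (c • A) = c * v A := by
    intro c A
    obtain ⟨l, x₁, y₁, h₁⟩ := A.isSigmaNuclear
    have h := h₁.smul c
    rw [← map_smul] at h
    refine tendsto_nhds_unique (hv (c • A) _ _ _ h) (((hv A _ _ _ h₁).const_mul c).congr ?_)
    intro N
    simp [Finset.mul_sum, mul_assoc]
  refine ⟨LinearMap.mkContinuous ⟨⟨v, hadd⟩, hsmul⟩ ‖S‖ fun A =>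
    IsTrace.norm_le hp.out hS A.isSigmaNuclear (hv A), ?_⟩
  apply TauSumming.toCMM_injective
  ext x' y
  rw [toCMM_borelLinear, borelForm_apply]
  change v (tensor p x' y) = _
  refine tendsto_nhds_unique (hv _ _ _ _ (isSigmaRep_tensor x' y)) ?_
  refine tendsto_const_nhds.congr' ((Filter.eventually_ge_atTop 1).mono fun N hN => ?_)
  dsimp only
  rw [Finset.sum_eq_single_of_mem 0 (Finset.mem_range.2 hN)]
  · rw [single_apply_zero, if_pos rfl, one_mul]
  · intro j _ hj
    rw [if_neg hj, map_zero, mul_zero]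

end Borel

theorem corollary3p3 {𝕜 : Type*} [RCLike 𝕜] {n : ℕ} (hn : 1 ≤ n)
    (E : Fin n → Type*) [∀ i, NormedAddCommGroup (E i)] [∀ i, NormedSpace 𝕜 (E i)]
    [∀ i, CompleteSpace (E i)]
    (F : Type*) [NormedAddCommGroup F] [NormedSpace 𝕜 F] [CompleteSpace F]
    (p : ℝ) [Fact (1 ≤ p)]
    (hE : ∀ i, HasBoundedApproximationProperty 𝕜 (StrongDual 𝕜 (E i)))
    (hF : IsReflexiveSpace 𝕜 F) :
    ∃ B : StrongDual 𝕜 (SigmaNuclear 𝕜 E F p) ≃ₗᵢ[𝕜]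
        TauSumming 𝕜 (fun i => StrongDual 𝕜 (E i)) (StrongDual 𝕜 F) p,
      ∀ (φ : StrongDual 𝕜 (SigmaNuclear 𝕜 E F p)) (x' : ∀ i, StrongDual 𝕜 (E i)) (y : F),
        TauSumming.toCMM (B φ) x' y = φ (SigmaNuclear.tensor p x' y) := by
  refine ⟨LinearIsometryEquiv.ofSurjective ⟨borelLinear hF, norm_borelLinear hF⟩
    (borelLinear_surjective hF hE), fun φ x' y => ?_⟩
  exact borelForm_apply φ x' y

end
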